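/- Let $(T_i)_{i\ge1}$ and $(Y_i)_{i\ge1}$ be two sequences of nonnegative random variables on one probability space, each negatively associated (NA): for any disjoint finite index sets $B_1,B_2$ and any measurable $\varphi_1,\varphi_2$ that are both increasing, or both decreasing, in every variable, $\operatorname{cov}(\varphi_1(T_i;i\in B_1),\varphi_2(T_j;j\in B_2))\le 0$ whenever this covariance exists, and likewise for $(Y_i)$. Suppose that the sequence $(T_i)$ is independent of the sequence $(Y_i)$, that the $T_i$ have a common distribution function $F$ with density $f$, and that the $Y_i$ have a common distribution function $G$. Put $X_i=\min(T_i,Y_i)$ and $\delta_i=\mathbf 1\{T_i\le Y_i\}$, let $L$ be the distribution function of $X_1$, and set $a_F=\inf\{x:F(x)>0\}$, $\tau_L=\sup\{x:L(x)<1\}\in(0,\infty]$. Let $a_F<\tau<\tau_L$, and suppose that $G$ has a density $g$ on $[0,\tau]$ and that $f$ and $g$ are bounded on $[0,\tau]$. Let $k$ be a probability density of bounded variation on a finite interval $(r,s)$, $r<0<s$, vanishing outside $(r,s)$, and let $b_n>0$ satisfy $b_n\to0$ and $b_n^{-1}=o\big((n/\ln n)^{1/2}\big)$. With $N_n(t)=\sum_{i\le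 n}\mathbf 1\{X_i\le t,\delta_i=1\}$, $Y_n(t)=\sum_{i\le n}\mathbf 1\{X_i\ge t\}$, $\hat H_n(x)=\int_0^x dN_n(s)/Y_n(s)$, $h=f/(1-F)$ and $H(x)=\int_0^x h(s)\,ds$, define $$h_n(t)=b_n^{-1}\int_{a_F}^\infty k\Big(\frac{t-x}{b_n}\Big)d\hat H_n(x),\quad \bar h_n(t)=b_n^{-1}\int_{a_F}^\infty k\Big(\frac{t-x}{b_n}\Big)dH(x),\quad f_n^*(t)=b_n^{-1}\int_{a_F}^\infty k\Big(\frac{t-x}{b_n}\Big)dF_{*n}(x),$$ where $F_{*n}(x)=\frac1n\sum_{i\le n}\mathbf 1\{X_i\le x,\delta_i=1\}$. Then, almost surely, as $n\to\infty$, $$\sup_{0<t\le\tau}\Big|h_n(t)-\bar h_n(t)-\frac{f_n^*(t)-E f_n^*(t)}{1-L(t)}\Big|=O\Big(b_n^{-1}\Big(\frac{\ln n}{n}\Big)^{1/2}\Big).$$ The same holds if instead $F_{*n}(x)=\frac1n\sum_{i\le n}\mathbf 1\{T_i\le x\}$ in the definition of $f_n^*$. -/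

import Mathlib

open MeasureTheory ProbabilityTheory Filter Topology

namespace CensoredNA

noncomputable section

/-- A sequence of real random variables is negatively associated (NA): for any two disjoint finite
index sets `B₁`, `B₂` and any (Borel) functions `φ₁`, `φ₂` that are both increasing, or both
decreasing, in every variable, the covariance of `φ₁ (T i; i ∈ B₁)` and `φ₂ (T j; j ∈ B₂)` is
nonpositive whenever it exists. -/
def NegAssociated {Ω : Type*} [MeasurableSpace Ω] (μ : Measure Ω) (T : ℕ → Ω → ℝ) : Prop :=
  ∀ B₁ B₂ : Finset ℕ, Disjoint B₁ B₂ →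
    ∀ (φ₁ : (B₁ → ℝ) → ℝ) (φ₂ : (B₂ → ℝ) → ℝ), Measurable φ₁ → Measurable φ₂ →
      ((Monotone φ₁ ∧ Monotone φ₂) ∨ (Antitone φ₁ ∧ Antitone φ₂)) →
      Integrable (fun ω => φ₁ (fun i => T i ω)) μ →
      Integrable (fun ω => φ₂ (fun j => T j ω)) μ →
      Integrable (fun ω => φ₁ (fun i => T i ω) * φ₂ (fun j => T j ω)) μ →
      covariance (fun ω => φ₁ (fun i => T i ω)) (fun ω => φ₂ (fun j => T j ω)) μ ≤ 0

/-- The distribution function `t ↦ P(X ≤ t)` of a real random variable. -/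
def distFun {Ω : Type*} [MeasurableSpace Ω] (μ : Measure Ω) (X : Ω → ℝ) (t : ℝ) : ℝ :=
  cdf (μ.map X) t

/-- Left endpoint `inf {x : H x > 0}` of the support of a distribution function on `[0, ∞)`. -/
def leftEndpoint (H : ℝ → ℝ) : ℝ := sInf {x : ℝ | 0 < H x}

/-- Right endpoint `sup {x : H x < 1}` of the support of a distribution function, possibly `∞`. -/
def rightEndpoint (H : ℝ → ℝ) : EReal := ⨆ x ∈ {x : ℝ | H x < 1}, (x : EReal)

/-- The observed time `X i = min (T i) (Y i)`. The observation is uncensored (`δ i = 1`) exactly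
when `T i ≤ Y i`. -/
def obs {Ω : Type*} (T Y : ℕ → Ω → ℝ) (i : ℕ) (ω : Ω) : ℝ := min (T i ω) (Y i ω)

open Classical in
/-- The number at risk, `Y_n(t) = #{k : X k ≥ t}` over the first `n` observations. -/
def atRisk {Ω : Type*} (T Y : ℕ → Ω → ℝ) (n : ℕ) (ω : Ω) (t : ℝ) : ℕ :=
  ((Finset.range n).filter fun k => t ≤ obs T Y k ω).card

open Classical in
/-- The measure `dN_n`, where `N_n(t) = #{k : X k ≤ t, δ k = 1}` over the first `n`
observations. -/
def eventMeasure {Ω : Type*} (T Y : ℕ → Ω → ℝ) (n : ℕ) (ω : Ω) : Measure ℝ :=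
  ∑ k ∈ (Finset.range n).filter (fun k => T k ω ≤ Y k ω), Measure.dirac (obs T Y k ω)

/-- The measure `dĤ_n = dN_n / Y_n` of the Nelson–Aalen estimator
`Ĥ_n(x) = ∫_0^x dN_n(s) / Y_n(s)`. -/
def nelsonAalen {Ω : Type*} (T Y : ℕ → Ω → ℝ) (n : ℕ) (ω : Ω) : Measure ℝ :=
  (eventMeasure T Y n ω).withDensity fun s => ((atRisk T Y n ω s : ℕ) : ENNReal)⁻¹

/-- The measure `dF_{*n}`, with `F_{*n}(t) = n⁻¹ #{k : X k ≤ t, δ k = 1} = N_n(t) / n`. -/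
def subEmpirical {Ω : Type*} (T Y : ℕ → Ω → ℝ) (n : ℕ) (ω : Ω) : Measure ℝ :=
  (n : ENNReal)⁻¹ • eventMeasure T Y n ω

/-- The empirical measure of the survival times, with distribution function
`n⁻¹ #{k : T k ≤ t}`. -/
def survivalEmpirical {Ω : Type*} (T : ℕ → Ω → ℝ) (n : ℕ) (ω : Ω) : Measure ℝ :=
  (n : ENNReal)⁻¹ • ∑ k ∈ Finset.range n, Measure.dirac (T k ω)

/-- The hazard function `h = f / (1 - F)`. -/
def hazard (f F : ℝ → ℝ) (x : ℝ) : ℝ := f x / (1 - F x)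

/-- The measure `dH`, where `H(x) = ∫_0^x h(s) ds` is the cumulative hazard. -/
def cumHazard (f F : ℝ → ℝ) : Measure ℝ :=
  volume.withDensity fun x => ENNReal.ofReal (hazard f F x)

/-- Kernel smoothing of a measure: `b⁻¹ ∫_a^∞ k((t - x) / b) dν(x)`. -/
def smooth (k : ℝ → ℝ) (b a : ℝ) (ν : Measure ℝ) (t : ℝ) : ℝ :=
  b⁻¹ * ∫ x in Set.Ioi a, k ((t - x) / b) ∂ν

/-- The kernel hazard estimator `h_n(t) = b⁻¹ ∫_a^∞ k((t - x) / b) dĤ_n(x)`. -/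
def hazardEstimator {Ω : Type*} (T Y : ℕ → Ω → ℝ) (k : ℝ → ℝ) (b a : ℝ) (n : ℕ) (t : ℝ) (ω : Ω) :
    ℝ :=
  smooth k b a (nelsonAalen T Y n ω) t

/-- Its centring `b⁻¹ ∫_a^∞ k((t - x) / b) dH(x)`. -/
def hazardCentring (f F k : ℝ → ℝ) (b a t : ℝ) : ℝ :=
  smooth k b a (cumHazard f F) t

/-- `f_n^*(t) = b⁻¹ ∫_a^∞ k((t - x) / b) dF_{*n}(x)`, with `F_{*n}` the empirical
sub-distribution function of the uncensored observations. -/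
def fStar {Ω : Type*} (T Y : ℕ → Ω → ℝ) (k : ℝ → ℝ) (b a : ℝ) (n : ℕ) (t : ℝ) (ω : Ω) : ℝ :=
  smooth k b a (subEmpirical T Y n ω) t

/-- The variant of `f_n^*` in which `F_{*n}` is the empirical distribution function
`n⁻¹ #{k : T k ≤ t}` of the survival times. -/
def fStarSurvival {Ω : Type*} (T : ℕ → Ω → ℝ) (k : ℝ → ℝ) (b a : ℝ) (n : ℕ) (t : ℝ) (ω : Ω) : ℝ :=
  smooth k b a (survivalEmpirical T n ω) t

/-- `sup_{0 < t ≤ τ} |D n t| = O(b_n⁻¹ (n⁻¹ ln n)^{1/2})` as `n → ∞`. -/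
def UniformRate (τ : ℝ) (b : ℕ → ℝ) (D : ℕ → ℝ → ℝ) : Prop :=
  ∃ C : ℝ, ∀ᶠ n : ℕ in atTop, ∀ t ∈ Set.Ioc 0 τ,
    |D n t| ≤ C * ((b n)⁻¹ * Real.sqrt (Real.log n / n))

end

end CensoredNA

namespace CensoredNA

/-! No cancellation between the hazard error and its linear term is needed. `h_n - h̄_n` and `f_n^*
- E f_n^*` are each of order `b_n⁻¹ (ln n / n)^{1/2}` almost surely, and `1 - L` is bounded below on
`(0, τ]`, so the triangle inequality suffices.

Both bounds rest on one fact (`ae_eventually_abs_empirical_sub_le`): the empirical measures of the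
`X i`, of the uncensored `X i` and of the `T i` are within `3 (ln n / n)^{1/2}` of their means,
uniformly over lower sets. A count of `(T i, Y i) ∈ W` is handled by Chernoff's method. If `W` is
monotone in each coordinate separately, the exponential factors are too. Negative association of `T`
with `Y` frozen, then of `Y` after averaging out `T`, bounds the joint moment generating function by
the product of the marginal ones (`integral_prod_le_pow`), and Hoeffding's lemma gives the i.i.d.
tail. The directions in the two coordinates may differ, which is what admits the uncensored region.
Bracketing by about `n` quantile rays and Borel–Cantelli make the bound uniform.

A kernel of bounded variation is a difference of bounded monotone functions, whose superlevel sets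
are intervals, so integrals against it inherit the uniform bound (`abs_integral_sub_le`). For the
hazard, `dĤ_n` and `dH` are the empirical and true uncensored laws weighted by the reciprocals of
the empirical and true `P(X ≥ x)`. One first exchanges the weights, then the measures. -/

/-! ### Lower sets, bracketing, and integrals of monotone functions. -/

theorem measureReal_le_of_compact_subset {ν : Measure ℝ} [IsFiniteMeasure ν] {A : Set ℝ}
    (hA : MeasurableSet A) {c : ℝ} (hc : 0 ≤ c)
    (h : ∀ K ⊆ A, IsCompact K → K.Nonempty → ν.real K ≤ c) : ν.real A ≤ c := by
  refine ENNReal.toReal_le_of_le_ofReal hc ?_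
  rw [hA.measure_eq_iSup_isCompact]
  refine iSup_le fun K => iSup_le fun hKA => iSup_le fun hK => ?_
  rcases K.eq_empty_or_nonempty with rfl | hne
  · simp
  · exact (ENNReal.le_ofReal_iff_toReal_le (measure_ne_top _ _) hc).2 (h K hKA hK hne)

/-- A compact subset has a greatest element, so inner regularity avoids distinguishing whether the
supremum of `A` is attained, missed or infinite. -/
theorem measureReal_le_of_Iic_le {ν : Measure ℝ} [IsFiniteMeasure ν] {A : Set ℝ}
    (hA : MeasurableSet A) {c : ℝ} (hc : 0 ≤ c) (h : ∀ t ∈ A, ν.real (Set.Iic t) ≤ c) :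
    ν.real A ≤ c := by
  refine measureReal_le_of_compact_subset hA hc fun K hKA hK hne => ?_
  obtain ⟨t, ht, hmax⟩ := hK.exists_isGreatest hne
  exact (measureReal_mono fun x hx => hmax hx).trans (h t (hKA ht))

theorem measureReal_le_of_Ici_le {ν : Measure ℝ} [IsFiniteMeasure ν] {A : Set ℝ}
    (hA : MeasurableSet A) {c : ℝ} (hc : 0 ≤ c) (h : ∀ t ∈ A, ν.real (Set.Ici t) ≤ c) :
    ν.real A ≤ c := by
  refine measureReal_le_of_compact_subset hA hc fun K hKA hK hne => ?_
  obtain ⟨t, ht, hmin⟩ := hK.exists_isLeast hne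
  exact (measureReal_mono fun x hx => hmin hx).trans (h t (hKA ht))

/-- Outer bracketing rays. -/
def upperBracket (ν : Measure ℝ) (m j : ℕ) : Set ℝ := {t | ν.real (Set.Iic t) ≤ j / m}

/-- Inner bracketing rays. -/
def lowerBracket (ν : Measure ℝ) (m j : ℕ) : Set ℝ := {t | ν.real (Set.Iio t) < j / m}

theorem isLowerSet_upperBracket (ν : Measure ℝ) [IsFiniteMeasure ν] (m j : ℕ) :
    IsLowerSet (upperBracket ν m j) := fun _ _ hba ha =>
  (measureReal_mono (Set.Iic_subset_Iic.2 hba)).trans ha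

theorem isLowerSet_lowerBracket (ν : Measure ℝ) [IsFiniteMeasure ν] (m j : ℕ) :
    IsLowerSet (lowerBracket ν m j) := fun _ _ hba ha =>
  (measureReal_mono (Set.Iio_subset_Iio hba)).trans_lt ha

theorem measurableSet_of_isLowerSet {S : Set ℝ} (hS : IsLowerSet S) : MeasurableSet S :=
  hS.ordConnected.measurableSet

/-- Every lower set lies between two of finitely many lower sets whose measures differ by at most
`1 / m`. -/
theorem exists_bracket (ν : Measure ℝ) [IsFiniteMeasure ν] (hν : ν.real Set.univ ≤ 1) {m : ℕ}
    (hm : 0 < m) {S : Set ℝ} (hS : IsLowerSet S) :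
    ∃ j ≤ m, lowerBracket ν m j ⊆ S ∧ S ⊆ upperBracket ν m (j + 1) ∧
      ν.real S - 1 / m ≤ ν.real (lowerBracket ν m j) ∧
      ν.real (upperBracket ν m (j + 1)) ≤ ν.real S + 1 / m := by
  have hm' : (0 : ℝ) < m := by exact_mod_cast hm
  have hSm := measurableSet_of_isLowerSet hS
  -- The grid level of `S`: `j / m ≤ ν S < (j + 1) / m`. The strict condition on open rays and the
  -- weak one on closed rays keep both brackets valid when `ν` has atoms.
  set j := ⌊m * ν.real S⌋₊ with hj
  have h0 : 0 ≤ m * ν.real S := by positivity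
  have h1 : (j : ℝ) ≤ m * ν.real S := Nat.floor_le h0
  have h2 : m * ν.real S < j + 1 := Nat.lt_floor_add_one _
  have hS1 : ν.real S ≤ 1 := (measureReal_mono (Set.subset_univ S)).trans hν
  have h1' : (j : ℝ) / m ≤ ν.real S := by rw [div_le_iff₀ hm']; linarith
  have h2' : ν.real S < (j + 1 : ℝ) / m := by rw [lt_div_iff₀ hm']; linarith
  have hadd : ((j : ℝ) + 1) / m = j / m + 1 / m := add_div _ _ _
  refine ⟨j, ?_, ?_, ?_, ?_, ?_⟩
  · have : (j : ℝ) ≤ m := h1.trans (by nlinarith)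
    exact_mod_cast this
  · intro t ht
    by_contra htS
    have : ν.real S ≤ ν.real (Set.Iio t) := measureReal_mono fun x hx =>
      lt_of_not_ge fun h => htS (hS h hx)
    have ht' : ν.real (Set.Iio t) < j / m := ht
    linarith
  · intro t ht
    have : ν.real (Set.Iic t) ≤ ν.real S := measureReal_mono fun x hx => hS hx ht
    change ν.real (Set.Iic t) ≤ ((j + 1 : ℕ) : ℝ) / m
    push_cast
    linarith
  · have hBm := measurableSet_of_isLowerSet (isLowerSet_lowerBracket ν m j)
    have hle : ν.real (lowerBracket ν m j)ᶜ ≤ ν.real Set.univ - j / m := by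
      refine measureReal_le_of_Ici_le hBm.compl ?_ fun t ht => ?_
      · have := measureReal_mono (μ := ν) (Set.subset_univ S)
        linarith
      · have ht' : (j : ℝ) / m ≤ ν.real (Set.Iio t) := not_lt.1 ht
        have := measureReal_compl (μ := ν) (measurableSet_Iio (a := t))
        rw [Set.compl_Iio] at this
        linarith
    rw [measureReal_compl hBm] at hle
    linarith
  · have : ν.real (upperBracket ν m (j + 1)) ≤ ((j + 1 : ℕ) : ℝ) / m :=
      measureReal_le_of_Iic_le
        (measurableSet_of_isLowerSet (isLowerSet_upperBracket ν m (j + 1))) (by positivity)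
        fun t ht => ht
    push_cast at this
    linarith

/-- An interval is its lower closure minus a smaller lower set, and each of the two costs one `δ`.
-/
theorem abs_measureReal_sub_le_of_ordConnected {ν₁ ν₂ : Measure ℝ} [IsFiniteMeasure ν₁]
    [IsFiniteMeasure ν₂] {δ : ℝ} (h : ∀ S, IsLowerSet S → |ν₁.real S - ν₂.real S| ≤ δ)
    {I : Set ℝ} (hI : I.OrdConnected) : |ν₁.real I - ν₂.real I| ≤ 2 * δ := by
  have hU : IsLowerSet (lowerClosure I : Set ℝ) := (lowerClosure I).lower
  have hD : IsLowerSet ((lowerClosure I : Set ℝ) \ I) := by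
    rintro y x hxy ⟨hy, hyI⟩
    refine ⟨hU hxy hy, fun hx => hyI ?_⟩
    obtain ⟨z, hz, hyz⟩ := hy
    exact hI.out hx hz ⟨hxy, hyz⟩
  have key : ∀ (ν : Measure ℝ) [IsFiniteMeasure ν],
      ν.real I = ν.real (lowerClosure I : Set ℝ) - ν.real ((lowerClosure I : Set ℝ) \ I) := by
    intro ν _
    rw [measureReal_sdiff subset_lowerClosure hI.measurableSet]
    ring
  have h1 := h _ hU
  have h2 := h _ hD
  rw [key ν₁, key ν₂]
  rw [abs_le] at *
  constructor <;> linarith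

theorem measurable_indicator_of_monotoneOn {J : Set ℝ} (hJ : J.OrdConnected) {φ : ℝ → ℝ}
    (hφ : MonotoneOn φ J) (h0 : ∀ x ∈ J, 0 ≤ φ x) : Measurable (J.indicator φ) := by
  refine measurable_of_Ioi fun u => ?_
  rcases lt_or_ge u 0 with hu | hu
  · convert MeasurableSet.univ
    ext x
    simp only [Set.mem_preimage, Set.mem_Ioi, Set.mem_univ, iff_true]
    exact hu.trans_le (Set.indicator_nonneg h0 x)
  · refine Set.OrdConnected.measurableSet ⟨fun x hx y hy z hz => ?_⟩
    have hxJ : x ∈ J := by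
      by_contra hxJ
      simp [hxJ, hu.not_gt] at hx
    have hyJ : y ∈ J := by
      by_contra hyJ
      simp [hyJ, hu.not_gt] at hy
    have hzJ := hJ.out hxJ hyJ hz
    simp only [Set.mem_preimage, Set.mem_Ioi, Set.indicator_of_mem hxJ] at hx
    simp only [Set.mem_preimage, Set.mem_Ioi, Set.indicator_of_mem hzJ]
    exact hx.trans_le (hφ hxJ hzJ hz.1)

/-- Integrals of a bounded function that is monotone on an interval are controlled by the
Kolmogorov distance of the two measures. -/
theorem abs_setIntegral_sub_le_of_monotoneOn {ν₁ ν₂ : Measure ℝ} [IsFiniteMeasure ν₁]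
    [IsFiniteMeasure ν₂] {δ : ℝ} (h : ∀ S, IsLowerSet S → |ν₁.real S - ν₂.real S| ≤ δ)
    {J : Set ℝ} (hJ : J.OrdConnected) {φ : ℝ → ℝ} (hφ : MonotoneOn φ J) {M : ℝ} (hM : 0 ≤ M)
    (h0 : ∀ x ∈ J, 0 ≤ φ x) (h1 : ∀ x ∈ J, φ x ≤ M) :
    |∫ x in J, φ x ∂ν₁ - ∫ x in J, φ x ∂ν₂| ≤ M * (2 * δ) := by
  have hmeas := measurable_indicator_of_monotoneOn hJ hφ h0
  have hle : ∀ x, J.indicator φ x ≤ M := fun x => Set.indicator_le' h1 (fun _ _ => hM) x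
  have hnn : ∀ x, 0 ≤ J.indicator φ x := fun x => Set.indicator_nonneg h0 x
  have hint : ∀ (ν : Measure ℝ) [IsFiniteMeasure ν], Integrable (J.indicator φ) ν := by
    intro ν _
    refine Integrable.of_bound hmeas.aestronglyMeasurable M (ae_of_all _ fun x => ?_)
    rw [Real.norm_of_nonneg (hnn x)]
    exact hle x
  -- Layer cake: the integral is an average of measures of superlevel sets. These are intervals by
  -- monotonicity, and they are empty above level `M`.
  have hlayer : ∀ (ν : Measure ℝ) [IsFiniteMeasure ν],
      ∫ x in J, φ x ∂ν = ∫ u in Set.Ioc 0 M, ν.real {x | u < J.indicator φ x} := by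
    intro ν _
    rw [← integral_indicator hJ.measurableSet,
      (hint ν).integral_eq_integral_meas_lt (ae_of_all _ hnn)]
    refine setIntegral_eq_of_subset_of_forall_sdiff_eq_zero measurableSet_Ioi
      Set.Ioc_subset_Ioi_self fun u hu => ?_
    have : {x | u < J.indicator φ x} = ∅ := by
      ext x
      simp only [Set.mem_ofPred_eq, Set.mem_empty_iff_false, iff_false, not_lt]
      have : ¬ u ≤ M := fun hu' => hu.2 ⟨hu.1, hu'⟩
      exact (hle x).trans (not_le.1 this).le
    simp [this]
  have hanti : ∀ (ν : Measure ℝ) [IsFiniteMeasure ν],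
      Antitone fun u => ν.real {x | u < J.indicator φ x} := fun ν _ u v huv =>
    measureReal_mono fun x hx => lt_of_le_of_lt huv hx
  have hintu : ∀ (ν : Measure ℝ) [IsFiniteMeasure ν],
      IntegrableOn (fun u => ν.real {x | u < J.indicator φ x}) (Set.Ioc 0 M) volume := by
    intro ν _
    refine Integrable.of_bound (hanti ν).measurable.aestronglyMeasurable (ν.real Set.univ)
      (ae_of_all _ fun u => ?_)
    rw [Real.norm_of_nonneg measureReal_nonneg]
    exact measureReal_mono (Set.subset_univ _)
  rw [hlayer ν₁, hlayer ν₂, ← integral_sub (hintu ν₁) (hintu ν₂), ← Real.norm_eq_abs]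
  have := norm_setIntegral_le_of_norm_le_const (μ := volume) (s := Set.Ioc 0 M) (C := 2 * δ)
    (f := fun u => ν₁.real {x | u < J.indicator φ x} - ν₂.real {x | u < J.indicator φ x})
    (by simp) fun u hu => ?_
  · refine this.trans (le_of_eq ?_)
    simp [hM]
    ring
  · rw [Real.norm_eq_abs]
    refine abs_measureReal_sub_le_of_ordConnected h ⟨fun x hx y hy z hz => ?_⟩
    have hxJ : x ∈ J := by
      by_contra hxJ
      simp [hxJ, hu.1.not_gt] at hx
    have hyJ : y ∈ J := by
      by_contra hyJ
      simp [hyJ, hu.1.not_gt] at hy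
    have hzJ := hJ.out hxJ hyJ hz
    simp only [Set.mem_ofPred_eq, Set.indicator_of_mem hxJ] at hx
    simp only [Set.mem_ofPred_eq, Set.indicator_of_mem hzJ]
    exact hx.trans_le (hφ hxJ hzJ hz.1)


/-! ### Product inequalities from negative association. -/

section NegativeAssociation

variable {Ω : Type*} [MeasurableSpace Ω] {μ : Measure Ω} [IsProbabilityMeasure μ]

theorem prod_le_pow_of_le {ι : Type*} {f : ι → ℝ} {M : ℝ} (h0 : ∀ i, 0 ≤ f i) (hM : ∀ i, f i ≤ M)
    (s : Finset ι) : ∏ i ∈ s, f i ≤ M ^ s.card :=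
  (Finset.prod_le_prod (fun i _ => h0 i) fun i _ => hM i).trans (by simp)

theorem memLp_prod_of_bounded {T : ℕ → Ω → ℝ} (hTm : ∀ i, Measurable (T i))
    {φ : ℕ → ℝ → ℝ} (hφm : ∀ i, Measurable (φ i)) {M : ℝ} (h0 : ∀ i x, 0 ≤ φ i x)
    (hM : ∀ i x, φ i x ≤ M) (s : Finset ℕ) :
    MemLp (fun ω => ∏ i ∈ s, φ i (T i ω)) 2 μ := by
  refine MemLp.of_bound (C := M ^ s.card) ?_ (ae_of_all _ fun ω => ?_)
  · exact (Finset.measurable_prod _ fun i _ => (hφm i).comp (hTm i)).aestronglyMeasurable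
  · rw [Real.norm_of_nonneg (Finset.prod_nonneg fun i _ => h0 _ _)]
    exact prod_le_pow_of_le (fun i => h0 _ _) (fun i => hM _ _) s

/-- Negatively associated variables satisfy `E ∏ φ i (T i) ≤ ∏ E φ i (T i)` for bounded nonnegative
functions that are all increasing or all decreasing. -/
theorem NegAssociated.integral_prod_le {T : ℕ → Ω → ℝ} (hT : NegAssociated μ T)
    (hTm : ∀ i, Measurable (T i)) {φ : ℕ → ℝ → ℝ} (hφm : ∀ i, Measurable (φ i)) {M : ℝ}
    (h0 : ∀ i x, 0 ≤ φ i x) (hM : ∀ i x, φ i x ≤ M)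
    (hmono : (∀ i, Monotone (φ i)) ∨ ∀ i, Antitone (φ i)) (n : ℕ) :
    ∫ ω, ∏ i ∈ Finset.range n, φ i (T i ω) ∂μ ≤ ∏ i ∈ Finset.range n, ∫ ω, φ i (T i ω) ∂μ := by
  induction n with
  | zero => simp
  | succ n ih =>
    have hL1 := memLp_prod_of_bounded (μ := μ) hTm hφm h0 hM (Finset.range n)
    have hL2 : MemLp (fun ω => φ n (T n ω)) 2 μ := by
      simpa using memLp_prod_of_bounded (μ := μ) hTm hφm h0 hM {n}
    -- Peel off the last factor. The product of the others is monotone in the same direction because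
    -- all factors are nonnegative.
    have hcov := hT (Finset.range n) {n} (by simp)
      (fun x => ∏ i : Finset.range n, φ i (x i)) (fun x => φ n (x ⟨n, by simp⟩))
      (Finset.measurable_prod _ fun i _ => (hφm i).comp (measurable_pi_apply i))
      ((hφm n).comp (measurable_pi_apply _))
      (by
        rcases hmono with h | h
        · exact Or.inl ⟨fun x y hxy => Finset.prod_le_prod (fun i _ => h0 _ _)
            fun i _ => h i (hxy i), fun x y hxy => h n (hxy _)⟩
        · exact Or.inr ⟨fun x y hxy => Finset.prod_le_prod (fun i _ => h0 _ _)
            fun i _ => h i (hxy i), fun x y hxy => h n (hxy _)⟩)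
    have hprod : ∀ ω, ∏ i : Finset.range n, φ i (T i ω) = ∏ i ∈ Finset.range n, φ i (T i ω) :=
      fun ω => Finset.prod_coe_sort (Finset.range n) fun i => φ i (T i ω)
    simp only [hprod] at hcov
    have := hcov (hL1.integrable (by norm_num)) (hL2.integrable (by norm_num))
      (hL1.integrable_mul hL2)
    rw [covariance_eq_sub hL1 hL2] at this
    simp only [Pi.mul_apply] at this
    simp only [Finset.prod_range_succ]
    refine (sub_nonpos.1 this).trans ?_
    exact mul_le_mul_of_nonneg_right ih (integral_nonneg fun ω => h0 _ _)

/-- Two independent negatively associated sequences, each identically distributed. -/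
structure IndepNAPair (μ : Measure Ω) (T Y : ℕ → Ω → ℝ) : Prop where
  left_na : NegAssociated μ T
  right_na : NegAssociated μ Y
  left_meas : ∀ i, Measurable (T i)
  right_meas : ∀ i, Measurable (Y i)
  left_law : ∀ i, μ.map (T i) = μ.map (T 0)
  right_law : ∀ i, μ.map (Y i) = μ.map (Y 0)
  indep : IndepFun (fun ω i => T i ω) (fun ω i => Y i ω) μ

/-- The product inequality for a pair of independent negatively associated sequences. -/
theorem IndepNAPair.integral_prod_le_pow {T Y : ℕ → Ω → ℝ} (hp : IndepNAPair μ T Y)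
    {ψ : ℝ → ℝ → ℝ} (hψm : Measurable (Function.uncurry ψ)) {M : ℝ} (h0 : ∀ t y, 0 ≤ ψ t y)
    (hM : ∀ t y, ψ t y ≤ M)
    (hmT : (∀ y, Monotone fun t => ψ t y) ∨ ∀ y, Antitone fun t => ψ t y)
    (hmY : (∀ t, Monotone fun y => ψ t y) ∨ ∀ t, Antitone fun y => ψ t y) (n : ℕ) :
    ∫ ω, ∏ i ∈ Finset.range n, ψ (T i ω) (Y i ω) ∂μ ≤ (∫ ω, ψ (T 0 ω) (Y 0 ω) ∂μ) ^ n := by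
  obtain ⟨hT, hY, hTm, hYm, hTid, hYid, hTY⟩ := hp
  have hTm' : Measurable fun ω (i : ℕ) => T i ω := measurable_pi_lambda _ hTm
  have hYm' : Measurable fun ω (i : ℕ) => Y i ω := measurable_pi_lambda _ hYm
  have hψ1 : ∀ y, Measurable fun t => ψ t y := fun y =>
    hψm.comp (by fun_prop : Measurable fun t => (t, y))
  have hlaw := (indepFun_iff_map_prod_eq_prod_map_map hTm'.aemeasurable hYm'.aemeasurable).1 hTY
  have fub : ∀ (Φ : (ℕ → ℝ) → (ℕ → ℝ) → ℝ), Measurable (Function.uncurry Φ) →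
      ∀ C : ℝ, (∀ x y, 0 ≤ Φ x y) → (∀ x y, Φ x y ≤ C) →
      ∫ ω, Φ (fun i => T i ω) (fun i => Y i ω) ∂μ =
        ∫ ω, ∫ ω', Φ (fun i => T i ω') (fun i => Y i ω) ∂μ ∂μ := by
    intro Φ hΦ C hC0 hC
    have := Measure.isProbabilityMeasure_map (μ := μ) hTm'.aemeasurable
    have := Measure.isProbabilityMeasure_map (μ := μ) hYm'.aemeasurable
    have hsw : Measurable (fun z : (ℕ → ℝ) × (ℕ → ℝ) => Φ z.1 z.2) := hΦ
    have e1 : ∫ ω, Φ (fun i => T i ω) (fun i => Y i ω) ∂μ =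
        ∫ z, Φ z.1 z.2 ∂(μ.map fun ω => ((fun i => T i ω), (fun i => Y i ω))) := by
      rw [integral_map (by fun_prop) hsw.aestronglyMeasurable]
    rw [e1, hlaw, integral_prod_symm]
    · rw [integral_map hYm'.aemeasurable]
      · refine integral_congr_ae (ae_of_all _ fun ω => ?_)
        simp only
        rw [integral_map hTm'.aemeasurable]
        exact (hsw.comp (by fun_prop : Measurable fun x : ℕ → ℝ =>
          (x, fun i => Y i ω))).aestronglyMeasurable
      · exact (hsw.stronglyMeasurable.integral_prod_left').aestronglyMeasurable
    · refine Integrable.of_bound hsw.aestronglyMeasurable C (ae_of_all _ fun z => ?_)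
      rw [Real.norm_of_nonneg (hC0 _ _)]
      exact hC _ _
  -- The average over `T` with `y` frozen. It keeps the monotonicity of `ψ` in `y`, so negative
  -- association of `Y` applies to it whatever the direction in `t`.
  set m : ℝ → ℝ := fun y => ∫ ω, ψ (T 0 ω) y ∂μ with hm
  have hint : ∀ i y, Integrable (fun ω => ψ (T i ω) y) μ := fun i y => by
    refine Integrable.of_bound ((hψ1 y).comp (hTm i)).aestronglyMeasurable M
      (ae_of_all _ fun ω => ?_)
    rw [Real.norm_of_nonneg (h0 _ _)]
    exact hM _ _
  have hmi : ∀ i y, ∫ ω, ψ (T i ω) y ∂μ = m y := fun i y => by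
    rw [hm, ← integral_map (hTm i).aemeasurable (f := fun t => ψ t y)
      (hψ1 y).aestronglyMeasurable, hTid i,
      integral_map (hTm 0).aemeasurable (hψ1 y).aestronglyMeasurable]
  have hm0 : ∀ y, 0 ≤ m y := fun y => integral_nonneg fun ω => h0 _ _
  have hmM : ∀ y, m y ≤ M := fun y => by
    refine (integral_mono (hint 0 y) (integrable_const M) fun ω => hM _ _).trans (by simp)
  have hmm : Measurable m := by
    have : StronglyMeasurable (fun z : ℝ × Ω => ψ (T 0 z.2) z.1) :=
      (hψm.comp (((hTm 0).comp measurable_snd).prodMk measurable_fst)).stronglyMeasurable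
    exact this.integral_prod_right'.measurable
  have hmmono : Monotone m ∨ Antitone m := by
    rcases hmY with h | h
    · exact Or.inl fun y y' hy => integral_mono (hint 0 _) (hint 0 _) fun ω => h _ hy
    · exact Or.inr fun y y' hy => integral_mono (hint 0 _) (hint 0 _) fun ω => h _ hy
  have hmYi : ∀ i, ∫ ω, m (Y i ω) ∂μ = ∫ ω, m (Y 0 ω) ∂μ := fun i => by
    rw [← integral_map (hYm i).aemeasurable hmm.aestronglyMeasurable, hYid i,
      integral_map (hYm 0).aemeasurable hmm.aestronglyMeasurable]
  have hone : ∫ ω, ψ (T 0 ω) (Y 0 ω) ∂μ = ∫ ω, m (Y 0 ω) ∂μ :=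
    fub (fun x y => ψ (x 0) (y 0))
      (hψm.comp (by fun_prop : Measurable fun z : (ℕ → ℝ) × (ℕ → ℝ) => (z.1 0, z.2 0))) M
      (fun _ _ => h0 _ _) fun _ _ => hM _ _
  calc ∫ ω, ∏ i ∈ Finset.range n, ψ (T i ω) (Y i ω) ∂μ
      = ∫ ω, ∫ ω', ∏ i ∈ Finset.range n, ψ (T i ω') (Y i ω) ∂μ ∂μ := by
        refine fub (fun x y => ∏ i ∈ Finset.range n, ψ (x i) (y i)) ?_ (M ^ n) ?_ ?_
        · exact Finset.measurable_prod _ fun i _ => hψm.comp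
            (by fun_prop : Measurable fun z : (ℕ → ℝ) × (ℕ → ℝ) => (z.1 i, z.2 i))
        · exact fun x y => Finset.prod_nonneg fun i _ => h0 _ _
        · intro x y
          simpa using prod_le_pow_of_le (fun i => h0 (x i) (y i)) (fun i => hM _ _) (Finset.range n)
    _ ≤ ∫ ω, ∏ i ∈ Finset.range n, m (Y i ω) ∂μ := by
        refine integral_mono_of_nonneg
          (ae_of_all _ fun ω => integral_nonneg fun ω' => Finset.prod_nonneg fun i _ => h0 _ _)
          ((memLp_prod_of_bounded hYm (fun _ => hmm) (fun _ => hm0) (fun _ => hmM)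
            _).integrable (by norm_num)) (ae_of_all _ fun ω => ?_)
        simp only
        have := hT.integral_prod_le hTm (φ := fun i t => ψ t (Y i ω)) (fun i => hψ1 _)
          (fun _ _ => h0 _ _) (fun _ _ => hM _ _)
          (hmT.imp (fun h i => h _) fun h i => h _) n
        simpa only [hmi] using this
    _ ≤ ∏ i ∈ Finset.range n, ∫ ω, m (Y i ω) ∂μ :=
        hY.integral_prod_le hYm (φ := fun _ => m) (fun _ => hmm) (fun _ => hm0) (fun _ => hmM)
          (hmmono.imp (fun h _ => h) fun h _ => h) n
    _ = (∫ ω, ψ (T 0 ω) (Y 0 ω) ∂μ) ^ n := by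
        simp [hmYi, hone]


end NegativeAssociation

/-! ### Hoeffding bounds and uniform convergence of empirical measures. -/

section Concentration

variable {Ω : Type*} [MeasurableSpace Ω] {μ : Measure Ω}

theorem IndepNAPair.measurable_pair {T Y : ℕ → Ω → ℝ} (hp : IndepNAPair μ T Y) (i : ℕ) :
    Measurable fun ω => (T i ω, Y i ω) := (hp.left_meas i).prodMk (hp.right_meas i)

variable [IsProbabilityMeasure μ]

/-- Centred counts of `(T i, Y i) ∈ W` are sub-Gaussian when `W` is decreasing in its first variable
and monotone in its second one. -/
theorem IndepNAPair.hasSubgaussianMGF_sum {T Y : ℕ → Ω → ℝ} (hp : IndepNAPair μ T Y)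
    {W : Set (ℝ × ℝ)} (hW : MeasurableSet W) (hWT : ∀ y, IsLowerSet {t | (t, y) ∈ W})
    (hWY : (∀ t, IsLowerSet {y | (t, y) ∈ W}) ∨ ∀ t, IsUpperSet {y | (t, y) ∈ W}) (n : ℕ) :
    HasSubgaussianMGF (fun ω => ∑ i ∈ Finset.range n,
      (W.indicator 1 (T i ω, Y i ω) - μ.real {ω | (T 0 ω, Y 0 ω) ∈ W})) (n / 4) μ := by
  set p := μ.real {ω | (T 0 ω, Y 0 ω) ∈ W} with hpdef
  set ξ : ℝ × ℝ → ℝ := W.indicator 1 with hξ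
  have hξm : Measurable ξ := measurable_one.indicator hW
  have hξ0 : ∀ z, 0 ≤ ξ z := fun z => Set.indicator_nonneg (fun _ _ => zero_le_one) z
  have hξ1 : ∀ z, ξ z ≤ 1 := fun z =>
    Set.indicator_le' (fun _ _ => le_rfl) (fun _ _ => zero_le_one) z
  have hξmono : ∀ {z z' : ℝ × ℝ}, (z ∈ W → z' ∈ W) → ξ z ≤ ξ z' := by
    intro z z' h
    by_cases hz : z ∈ W
    · simp [hξ, hz, h hz]
    · simpa [hξ, hz] using hξ0 z'
  have hp0 : 0 ≤ p := measureReal_nonneg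
  have hp1 : p ≤ 1 := measureReal_le_one
  have habs : ∀ z, |ξ z - p| ≤ 1 := fun z =>
    abs_le.2 ⟨by linarith [hξ0 z], by linarith [hξ1 z]⟩
  have hmean : ∫ ω, ξ (T 0 ω, Y 0 ω) ∂μ = p := by
    have : (fun ω => ξ (T 0 ω, Y 0 ω)) = ({ω | (T 0 ω, Y 0 ω) ∈ W} : Set Ω).indicator 1 := by
      ext ω
      by_cases h : (T 0 ω, Y 0 ω) ∈ W <;> simp [hξ, h]
    rw [this]
    exact integral_indicator_one (s := {ω | (T 0 ω, Y 0 ω) ∈ W}) (hp.measurable_pair 0 hW)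
  have hexp : ∀ t z, Real.exp (t * (ξ z - p)) ≤ Real.exp |t| := fun t z => by
    refine Real.exp_le_exp.2 ((le_abs_self _).trans ?_)
    rw [abs_mul]
    exact mul_le_of_le_one_right (abs_nonneg _) (habs z)
  have hprod : ∀ t ω, Real.exp (t * ∑ i ∈ Finset.range n, (ξ (T i ω, Y i ω) - p)) =
      ∏ i ∈ Finset.range n, Real.exp (t * (ξ (T i ω, Y i ω) - p)) := fun t ω => by
    rw [Finset.mul_sum, Real.exp_sum]
  constructor
  · intro t
    simp only [hprod]
    refine Integrable.of_bound (C := Real.exp |t| ^ (Finset.range n).card)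
      (Finset.measurable_prod _ fun i _ => ?_).aestronglyMeasurable (ae_of_all _ fun ω => ?_)
    · exact (((hξm.comp (hp.measurable_pair i)).sub_const p).const_mul t).exp
    · rw [Real.norm_of_nonneg (Finset.prod_nonneg fun i _ => (Real.exp_pos _).le)]
      exact prod_le_pow_of_le (fun i => (Real.exp_pos _).le) (fun i => hexp _ _) _
  · intro t
    -- Hoeffding's lemma for a single indicator gives variance proxy `1/4`. The product inequality
    -- adds these up to `n/4`.
    have hsub := hasSubgaussianMGF_of_mem_Icc (μ := μ) (X := fun ω => ξ (T 0 ω, Y 0 ω)) (a := 0)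
      (b := 1) (hξm.comp (hp.measurable_pair 0)).aemeasurable
      (ae_of_all _ fun ω => ⟨hξ0 _, hξ1 _⟩)
    have hone := hsub.mgf_le t
    rw [hmean] at hone
    have hmul : ∀ {u v : ℝ}, u ≤ v →
        (0 ≤ t → Real.exp (t * (u - p)) ≤ Real.exp (t * (v - p))) ∧
        (t ≤ 0 → Real.exp (t * (v - p)) ≤ Real.exp (t * (u - p))) := fun huv =>
      ⟨fun ht => Real.exp_le_exp.2 (by nlinarith), fun ht => Real.exp_le_exp.2 (by nlinarith)⟩
    have hT : ∀ y, Antitone fun x => ξ (x, y) := fun y x x' h => hξmono (hWT y h)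
    have hY : (∀ x, Antitone fun y => ξ (x, y)) ∨ ∀ x, Monotone fun y => ξ (x, y) :=
      hWY.imp (fun h x y y' hy => hξmono (h x hy)) fun h x y y' hy => hξmono (h x hy)
    have key := hp.integral_prod_le_pow (ψ := fun x y => Real.exp (t * (ξ (x, y) - p)))
      (M := Real.exp |t|) (((hξm.sub_const p).const_mul t).exp)
      (fun _ _ => (Real.exp_pos _).le) (fun _ _ => hexp _ _)
      -- The sign of `t` decides whether exponentiating preserves or reverses the directions of `ξ`.
      (by
        rcases le_total 0 t with ht | ht
        · exact Or.inr fun y x x' h => (hmul (hT y h)).1 ht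
        · exact Or.inl fun y x x' h => (hmul (hT y h)).2 ht)
      (by
        rcases le_total 0 t with ht | ht <;> rcases hY with hY | hY
        · exact Or.inr fun x y y' h => (hmul (hY x h)).1 ht
        · exact Or.inl fun x y y' h => (hmul (hY x h)).1 ht
        · exact Or.inl fun x y y' h => (hmul (hY x h)).2 ht
        · exact Or.inr fun x y y' h => (hmul (hY x h)).2 ht) n
    simp only [mgf, hprod]
    refine key.trans ((pow_le_pow_left₀ (integral_nonneg fun ω => (Real.exp_pos _).le)
      hone n).trans (le_of_eq ?_))
    rw [← Real.exp_nat_mul]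
    congr 1
    push_cast
    norm_num
    ring

theorem IndepNAPair.measure_abs_sum_ge_le {T Y : ℕ → Ω → ℝ} (hp : IndepNAPair μ T Y)
    {W : Set (ℝ × ℝ)} (hW : MeasurableSet W) (hWT : ∀ y, IsLowerSet {t | (t, y) ∈ W})
    (hWY : (∀ t, IsLowerSet {y | (t, y) ∈ W}) ∨ ∀ t, IsUpperSet {y | (t, y) ∈ W}) (n : ℕ)
    {ε : ℝ} (hε : 0 ≤ ε) :
    μ.real {ω | ε ≤ |∑ i ∈ Finset.range n,
      (W.indicator 1 (T i ω, Y i ω) - μ.real {ω | (T 0 ω, Y 0 ω) ∈ W})|} ≤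
      2 * Real.exp (-2 * ε ^ 2 / n) := by
  have h := hp.hasSubgaussianMGF_sum hW hWT hWY n
  have h1 := h.measure_ge_le hε
  have h2 := h.neg.measure_ge_le hε
  have he : Real.exp (-ε ^ 2 / (2 * ((n / 4 : NNReal) : ℝ))) = Real.exp (-2 * ε ^ 2 / n) := by
    congr 1
    rcases eq_or_ne n 0 with rfl | hn
    · simp
    · have : (n : ℝ) ≠ 0 := by exact_mod_cast hn
      push_cast
      field_simp
      ring
  rw [he] at h1 h2
  refine (measureReal_mono (fun ω hω => ?_)).trans
    ((measureReal_union_le _ _).trans ((add_le_add h1 h2).trans (by linarith)))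
  rcases le_abs.1 (show ε ≤ |_| from hω) with h' | h'
  · exact Or.inl h'
  · exact Or.inr h'

noncomputable section

open Classical in
/-- Empirical measure of the values `ζ (T i, Y i)`, `i < n`, for which `(T i, Y i) ∈ D`. -/
def empirical (T Y : ℕ → Ω → ℝ) (D : Set (ℝ × ℝ)) (ζ : ℝ × ℝ → ℝ) (n : ℕ) (ω : Ω) : Measure ℝ :=
  (n : ENNReal)⁻¹ • ∑ i ∈ (Finset.range n).filter (fun i => (T i ω, Y i ω) ∈ D),
    Measure.dirac (ζ (T i ω, Y i ω))

/-- The mean of `empirical`. -/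
def population (μ : Measure Ω) (T Y : ℕ → Ω → ℝ) (D : Set (ℝ × ℝ)) (ζ : ℝ × ℝ → ℝ) : Measure ℝ :=
  ((μ.map fun ω => (T 0 ω, Y 0 ω)).restrict D).map ζ

end

instance (T Y : ℕ → Ω → ℝ) (D : Set (ℝ × ℝ)) (ζ : ℝ × ℝ → ℝ) :
    IsFiniteMeasure (population μ T Y D ζ) := by
  unfold population; infer_instance

instance (T Y : ℕ → Ω → ℝ) (D : Set (ℝ × ℝ)) (ζ : ℝ × ℝ → ℝ) (n : ℕ) (ω : Ω) :
    IsFiniteMeasure (empirical T Y D ζ n ω) := by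
  rcases n.eq_zero_or_pos with rfl | hn
  · unfold empirical
    simp only [Finset.range_zero, Finset.filter_empty, Finset.sum_empty, smul_zero]
    infer_instance
  · refine Measure.smul_finite _ ?_
    simp [hn.ne']

theorem integral_empirical {Ω : Type*} (T Y : ℕ → Ω → ℝ) (D : Set (ℝ × ℝ)) (ζ : ℝ × ℝ → ℝ) (n : ℕ) (ω : Ω)
    (φ : ℝ → ℝ) : ∫ x, φ x ∂(empirical T Y D ζ n ω) =
      (n : ℝ)⁻¹ * ∑ i ∈ Finset.range n,
        D.indicator (fun z => φ (ζ z)) (T i ω, Y i ω) := by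
  classical
  rw [empirical, integral_smul_measure, integral_finsetSum_measure]
  · simp only [integral_dirac, Finset.sum_filter, Set.indicator_apply, smul_eq_mul,
      ENNReal.toReal_inv, ENNReal.toReal_natCast]
  · intro i _
    exact integrable_dirac (by simp)

theorem measureReal_empirical {Ω : Type*} (T Y : ℕ → Ω → ℝ) (D : Set (ℝ × ℝ)) (ζ : ℝ × ℝ → ℝ) (n : ℕ) (ω : Ω)
    {S : Set ℝ} (hS : MeasurableSet S) : (empirical T Y D ζ n ω).real S =
      (n : ℝ)⁻¹ * ∑ i ∈ Finset.range n, (D ∩ ζ ⁻¹' S).indicator 1 (T i ω, Y i ω) := by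
  rw [← integral_indicator_one hS, integral_empirical]
  congr 1
  refine Finset.sum_congr rfl fun i _ => ?_
  by_cases h : (T i ω, Y i ω) ∈ D <;> by_cases h' : ζ (T i ω, Y i ω) ∈ S <;>
    simp [h, h']

theorem IndepNAPair.measureReal_population {Ω : Type*} [MeasurableSpace Ω] {μ : Measure Ω}
    {T Y : ℕ → Ω → ℝ} (hp : IndepNAPair μ T Y)
    {D : Set (ℝ × ℝ)} {ζ : ℝ × ℝ → ℝ} (hD : MeasurableSet D) (hζ : Measurable ζ)
    {S : Set ℝ} (hS : MeasurableSet S) : (population μ T Y D ζ).real S =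
      μ.real {ω | (T 0 ω, Y 0 ω) ∈ D ∩ ζ ⁻¹' S} := by
  rw [population, map_measureReal_apply hζ hS, measureReal_restrict_apply (hζ hS),
    map_measureReal_apply (hp.measurable_pair 0) ((hζ hS).inter hD), Set.inter_comm]
  rfl

/-- Almost sure uniform rate `(ln n / n)^{1/2}` for the empirical distribution functions. -/
theorem IndepNAPair.ae_eventually_abs_empirical_sub_le {T Y : ℕ → Ω → ℝ} (hp : IndepNAPair μ T Y)
    {D : Set (ℝ × ℝ)} {ζ : ℝ × ℝ → ℝ} (hD : MeasurableSet D) (hζ : Measurable ζ)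
    (hWT : ∀ S, IsLowerSet S → ∀ y, IsLowerSet {t | (t, y) ∈ D ∩ ζ ⁻¹' S})
    (hWY : ∀ S, IsLowerSet S → (∀ t, IsLowerSet {y | (t, y) ∈ D ∩ ζ ⁻¹' S}) ∨
      ∀ t, IsUpperSet {y | (t, y) ∈ D ∩ ζ ⁻¹' S}) :
    ∀ᵐ ω ∂μ, ∀ᶠ n : ℕ in atTop, ∀ S, IsLowerSet S →
      |(empirical T Y D ζ n ω).real S - (population μ T Y D ζ).real S| ≤
        3 * Real.sqrt (Real.log n / n) := by
  set ν := population μ T Y D ζ with hν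
  have hν1 : ν.real Set.univ ≤ 1 := by
    rw [hν, hp.measureReal_population hD hζ .univ]
    exact measureReal_le_one
  -- With `ε = 2 n (ln n / n)^{1/2}` the exponent `-2 ε² / n` equals `-8 ln n`, so each tail is at
  -- most `2 n⁻⁸`. This is ample for a union over about `n` brackets and summation in `n`.
  set dev : ℕ → Set ℝ → Set Ω := fun n S => {ω | n * (2 * Real.sqrt (Real.log n / n)) ≤
    |∑ i ∈ Finset.range n, ((D ∩ ζ ⁻¹' S).indicator 1 (T i ω, Y i ω) -
      μ.real {ω | (T 0 ω, Y 0 ω) ∈ D ∩ ζ ⁻¹' S})|} with hdev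
  have hdevle : ∀ n : ℕ, 1 ≤ n → ∀ S, IsLowerSet S →
      μ.real (dev n S) ≤ 2 * ((n : ℝ) ^ 8)⁻¹ := by
    intro n hn S hS
    have hn' : (1 : ℝ) ≤ n := by exact_mod_cast hn
    have hlog : 0 ≤ Real.log n / n := div_nonneg (Real.log_nonneg hn') (by linarith)
    refine (hp.measure_abs_sum_ge_le (hD.inter (hζ (measurableSet_of_isLowerSet hS)))
      (hWT S hS) (hWY S hS) n (by positivity)).trans (le_of_eq ?_)
    congr 1
    rw [mul_pow, mul_pow, Real.sq_sqrt hlog, ← Real.exp_log (by positivity : (0 : ℝ) < (n : ℝ) ^ 8),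
      ← Real.exp_neg, Real.log_pow]
    congr 1
    push_cast
    field_simp
    ring
  -- Mesh `1 / n`. The outer bracket uses the index `j + 1 ≤ n + 1`, hence `n + 2` levels.
  set bad : ℕ → Set Ω := fun n => if n = 0 then ∅ else
    ⋃ j ∈ Finset.range (n + 2), (dev n (upperBracket ν n j) ∪ dev n (lowerBracket ν n j)) with hbad
  have hbadle : ∀ n, μ (bad n) ≤ ENNReal.ofReal (12 * (1 / (n : ℝ) ^ 2)) := by
    intro n
    rcases n.eq_zero_or_pos with rfl | hn
    · simp [hbad]
    · rw [ENNReal.le_ofReal_iff_toReal_le (measure_ne_top _ _) (by positivity)]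
      change μ.real (bad n) ≤ _
      have hn' : (1 : ℝ) ≤ n := by exact_mod_cast hn
      simp only [hbad, hn.ne', if_false]
      refine (measureReal_biUnion_finset_le _ _).trans ?_
      have : ∀ j ∈ Finset.range (n + 2),
          μ.real (dev n (upperBracket ν n j) ∪ dev n (lowerBracket ν n j)) ≤
            4 * ((n : ℝ) ^ 8)⁻¹ := fun j _ => by
        refine (measureReal_union_le _ _).trans ?_
        have := hdevle n hn _ (isLowerSet_upperBracket ν n j)
        have := hdevle n hn _ (isLowerSet_lowerBracket ν n j)
        linarith
      refine (Finset.sum_le_sum this).trans ?_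
      rw [Finset.sum_const, Finset.card_range, nsmul_eq_mul]
      push_cast
      have h3 : (n : ℝ) + 2 ≤ 3 * n ^ 6 := by
        have : (n : ℝ) ≤ n ^ 6 := le_self_pow₀ hn' (by norm_num)
        linarith
      have hpos : (0 : ℝ) < n := by linarith
      calc ((n : ℝ) + 2) * (4 * ((n : ℝ) ^ 8)⁻¹) ≤ (3 * n ^ 6) * (4 * ((n : ℝ) ^ 8)⁻¹) := by gcongr
        _ = 12 * (1 / (n : ℝ) ^ 2) := by field_simp; norm_num
  have hsum : ∑' n, μ (bad n) ≠ ⊤ := by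
    refine ne_top_of_le_ne_top ?_ (ENNReal.tsum_le_tsum hbadle)
    exact ((Real.summable_one_div_nat_pow.2 (by norm_num)).mul_left 12).tsum_ofReal_ne_top
  filter_upwards [ae_eventually_notMem hsum] with ω hω
  filter_upwards [hω, eventually_ge_atTop 3] with n hn hn3 S hS
  have hn0 : 0 < n := by omega
  have hnR : (3 : ℝ) ≤ n := by exact_mod_cast hn3
  have hnpos : (0 : ℝ) < n := by linarith
  set ρ := Real.sqrt (Real.log n / n) with hρ
  have hlog : 1 ≤ Real.log n := by
    rw [Real.le_log_iff_exp_le hnpos]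
    exact (Real.exp_one_lt_d9.le.trans (by norm_num)).trans hnR
  -- The bracketing error `1 / n` is absorbed into `ρ`, so that deviation `2ρ` plus mesh gives `3ρ`.
  have hρn : 1 / (n : ℝ) ≤ ρ := by
    refine Real.le_sqrt_of_sq_le ?_
    rw [one_div, inv_pow, ← one_div, div_le_div_iff₀ (by positivity) hnpos]
    nlinarith
  simp only [hbad, hn0.ne', if_false, Set.mem_iUnion, not_exists, Finset.mem_range,
    Set.mem_union, not_or] at hn
  have hgood : ∀ S, IsLowerSet S → ω ∉ dev n S →
      |(empirical T Y D ζ n ω).real S - ν.real S| ≤ 2 * ρ := by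
    intro S hS h
    have hSm := measurableSet_of_isLowerSet hS
    have h' : |∑ i ∈ Finset.range n, ((D ∩ ζ ⁻¹' S).indicator 1 (T i ω, Y i ω) -
      μ.real {ω | (T 0 ω, Y 0 ω) ∈ D ∩ ζ ⁻¹' S})| < n * (2 * ρ) := not_le.1 h
    rw [measureReal_empirical _ _ _ _ _ _ hSm, hν, hp.measureReal_population hD hζ hSm]
    rw [Finset.sum_sub_distrib, Finset.sum_const, Finset.card_range, nsmul_eq_mul] at h'
    set A : ℝ := ∑ i ∈ Finset.range n, (D ∩ ζ ⁻¹' S).indicator 1 (T i ω, Y i ω)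
    set p := μ.real {ω | (T 0 ω, Y 0 ω) ∈ D ∩ ζ ⁻¹' S}
    have : (n : ℝ)⁻¹ * A - p = (n : ℝ)⁻¹ * (A - n * p) := by field_simp
    rw [this, abs_mul, abs_of_pos (inv_pos.2 hnpos), inv_mul_le_iff₀ hnpos]
    exact h'.le
  obtain ⟨j, hj, hl, hu, hνl, hνu⟩ := exists_bracket ν hν1 hn0 hS
  have gl := hgood _ (isLowerSet_lowerBracket ν n j) (hn j (by omega)).2
  have gu := hgood _ (isLowerSet_upperBracket ν n (j + 1)) (hn (j + 1) (by omega)).1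
  have ml := measureReal_mono (μ := empirical T Y D ζ n ω) hl
  have mu := measureReal_mono (μ := empirical T Y D ζ n ω) hu
  rw [abs_le] at *
  constructor <;> linarith [gl.1, gu.2]


end Concentration

/-! ### Kernels of bounded variation. -/

/-- `k` vanishes off `(r, s)`, where it is the difference of two decreasing functions with values in
`[0, C]`. -/
structure AntitoneDecomposition (k P Q : ℝ → ℝ) (r s C : ℝ) : Prop where
  nonneg : 0 ≤ C
  antitone_left : AntitoneOn P (Set.Ioo r s)
  antitone_right : AntitoneOn Q (Set.Ioo r s)
  left_mem : ∀ u ∈ Set.Ioo r s, P u ∈ Set.Icc 0 C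
  right_mem : ∀ u ∈ Set.Ioo r s, Q u ∈ Set.Icc 0 C
  eq_sub : ∀ u ∈ Set.Ioo r s, k u = P u - Q u
  eq_zero : ∀ u ∉ Set.Ioo r s, k u = 0

/-- Jordan decomposition: with `p` the signed variation from a base point, both `p` and `p - k`
increase. Negating them and adding a constant gives nonnegative decreasing parts. -/
theorem exists_antitoneDecomposition {k : ℝ → ℝ} {r s : ℝ} (hrs : r < s)
    (hk : BoundedVariationOn k (Set.Ioo r s)) (h0 : ∀ u ∉ Set.Ioo r s, k u = 0) :
    ∃ P Q C, AntitoneDecomposition k P Q r s C := by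
  obtain ⟨c, hc⟩ := Set.nonempty_Ioo.2 hrs
  have hloc := hk.locallyBoundedVariationOn
  set V := (eVariationOn k (Set.Ioo r s)).toReal with hV
  set p := variationOnFromTo k (Set.Ioo r s) c with hp
  have hpV : ∀ u, |p u| ≤ V := by
    intro u
    have hmono : ∀ x y, (eVariationOn k (Set.Ioo r s ∩ Set.Icc x y)).toReal ≤ V := fun x y =>
      ENNReal.toReal_mono hk (eVariationOn.mono _ Set.inter_subset_left)
    rw [hp, variationOnFromTo]
    split_ifs
    · rw [abs_of_nonneg ENNReal.toReal_nonneg]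
      exact hmono _ _
    · rw [abs_neg, abs_of_nonneg ENNReal.toReal_nonneg]
      exact hmono _ _
  have hkV : ∀ u ∈ Set.Ioo r s, |k u| ≤ |k c| + V := fun u hu => by
    have := hk.dist_le hu hc
    rw [Real.dist_eq] at this
    have h2 := abs_add_le (k u - k c) (k c)
    rw [sub_add_cancel] at h2
    linarith
  have hmp := variationOnFromTo.monotoneOn hloc hc
  have hmq := variationOnFromTo.sub_self_monotoneOn hloc hc
  have hV0 : 0 ≤ V := ENNReal.toReal_nonneg
  have hk0 := abs_nonneg (k c)
  refine ⟨fun u => |k c| + 2 * V - (p u - k u), fun u => |k c| + 2 * V - p u,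
    2 * (|k c| + 2 * V), by positivity, fun u hu v hv huv => ?_, fun u hu v hv huv => ?_,
    fun u hu => ?_, fun u hu => ?_, fun u _ => by ring, h0⟩
  · exact sub_le_sub_left (hmq hu hv huv) _
  · exact sub_le_sub_left (hmp hu hv huv) _
  · have h1 := abs_le.1 (hpV u)
    have h2 := abs_le.1 (hkV u hu)
    constructor <;> linarith [h1.1, h1.2, h2.1, h2.2]
  · have h1 := abs_le.1 (hpV u)
    constructor <;> linarith [h1.1, h1.2]

namespace AntitoneDecomposition

variable {k P Q : ℝ → ℝ} {r s C : ℝ}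

theorem abs_le (hk : AntitoneDecomposition k P Q r s C) (u : ℝ) : |k u| ≤ C := by
  by_cases hu : u ∈ Set.Ioo r s
  · rw [hk.eq_sub u hu, _root_.abs_le]
    have h1 := hk.left_mem u hu
    have h2 := hk.right_mem u hu
    constructor <;> linarith [h1.1, h1.2, h2.1, h2.2]
  · rw [hk.eq_zero u hu, abs_zero]
    exact hk.nonneg

theorem measurable (hk : AntitoneDecomposition k P Q r s C) : Measurable k := by
  -- Reflection turns the decreasing parts into increasing ones, for which measurability is already
  -- known.
  have hJ : (Set.Ioo (-s) (-r)).OrdConnected := Set.ordConnected_Ioo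
  have hmem : ∀ {x}, x ∈ Set.Ioo (-s) (-r) ↔ -x ∈ Set.Ioo r s := fun {x} => by
    simp only [Set.mem_Ioo]
    constructor <;> rintro ⟨h, h'⟩ <;> constructor <;> linarith
  have hP := measurable_indicator_of_monotoneOn hJ (φ := fun x => P (-x))
    (fun x hx y hy hxy => hk.antitone_left (hmem.1 hy) (hmem.1 hx) (neg_le_neg hxy))
    fun x hx => (hk.left_mem _ (hmem.1 hx)).1
  have hQ := measurable_indicator_of_monotoneOn hJ (φ := fun x => Q (-x))
    (fun x hx y hy hxy => hk.antitone_right (hmem.1 hy) (hmem.1 hx) (neg_le_neg hxy))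
    fun x hx => (hk.right_mem _ (hmem.1 hx)).1
  convert (hP.sub hQ).comp measurable_neg using 1
  ext u
  by_cases hu : u ∈ Set.Ioo r s
  · have : -u ∈ Set.Ioo (-s) (-r) := hmem.2 (by simpa using hu)
    simp only [Function.comp_apply, Pi.sub_apply, Set.indicator_of_mem this, neg_neg]
    exact hk.eq_sub u hu
  · have : -u ∉ Set.Ioo (-s) (-r) := fun h => hu (by simpa using hmem.1 h)
    simp only [Function.comp_apply, Pi.sub_apply, Set.indicator_of_notMem this, sub_zero]
    exact hk.eq_zero u hu

/-- Weighted kernel integrals are controlled by the Kolmogorov distance of the measures. -/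
theorem abs_integral_sub_le (hk : AntitoneDecomposition k P Q r s C) {ν₁ ν₂ : Measure ℝ}
    [IsFiniteMeasure ν₁] [IsFiniteMeasure ν₂] {δ : ℝ}
    (h : ∀ S, IsLowerSet S → |ν₁.real S - ν₂.real S| ≤ δ) {b a t c : ℝ} (hb : 0 < b)
    (hc : ∀ x, (t - x) / b ∈ Set.Ioo r s → x ≤ c) {w : ℝ → ℝ} (hw : MonotoneOn w (Set.Iic c))
    {B : ℝ} (hB : 0 ≤ B) (hw0 : ∀ x ≤ c, 0 ≤ w x) (hwB : ∀ x ≤ c, w x ≤ B) :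
    |∫ x in Set.Ioi a, k ((t - x) / b) * w x ∂ν₁ - ∫ x in Set.Ioi a, k ((t - x) / b) * w x ∂ν₂| ≤
      4 * (C * B) * δ := by
  set J : Set ℝ := Set.Ioi a ∩ (fun x => (t - x) / b) ⁻¹' Set.Ioo r s with hJdef
  have hanti : Antitone fun x => (t - x) / b := fun x y hxy => by
    change (t - y) / b ≤ (t - x) / b
    gcongr
  have hJ : J.OrdConnected := by
    refine Set.ordConnected_Ioi.inter ⟨fun x hx y hy z hz => ?_⟩
    exact ⟨hy.1.trans_le (hanti hz.2), (hanti hz.1).trans_lt hx.2⟩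
  -- Since `x ↦ (t - x) / b` decreases, decreasing parts of `k` become increasing in `x`. Their
  -- products with the increasing weight `w` stay monotone.
  have hmono : ∀ {R : ℝ → ℝ}, AntitoneOn R (Set.Ioo r s) →
      (∀ u ∈ Set.Ioo r s, R u ∈ Set.Icc 0 C) →
      MonotoneOn (fun x => R ((t - x) / b) * w x) J ∧
      (∀ x ∈ J, 0 ≤ R ((t - x) / b) * w x) ∧ ∀ x ∈ J, R ((t - x) / b) * w x ≤ C * B := by
    intro R hR hRC
    refine ⟨fun x hx y hy hxy => ?_, fun x hx => ?_, fun x hx => ?_⟩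
    · exact mul_le_mul (hR hy.2 hx.2 (hanti hxy)) (hw (hc x hx.2) (hc y hy.2) hxy)
        (hw0 x (hc x hx.2)) (hRC _ hy.2).1
    · exact mul_nonneg (hRC _ hx.2).1 (hw0 x (hc x hx.2))
    · exact mul_le_mul (hRC _ hx.2).2 (hwB x (hc x hx.2)) (hw0 x (hc x hx.2)) hk.nonneg
  obtain ⟨hP, hP0, hPC⟩ := hmono hk.antitone_left hk.left_mem
  obtain ⟨hQ, hQ0, hQC⟩ := hmono hk.antitone_right hk.right_mem
  have hint : ∀ {φ : ℝ → ℝ}, MonotoneOn φ J → (∀ x ∈ J, 0 ≤ φ x) → (∀ x ∈ J, φ x ≤ C * B) →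
      ∀ (ν : Measure ℝ) [IsFiniteMeasure ν], IntegrableOn φ J ν := by
    intro φ hφ hφ0 hφC ν _
    refine (integrable_indicator_iff hJ.measurableSet).1 (Integrable.of_bound
      (measurable_indicator_of_monotoneOn hJ hφ hφ0).aestronglyMeasurable (C * B)
      (ae_of_all _ fun x => ?_))
    rw [Real.norm_of_nonneg (Set.indicator_nonneg hφ0 x)]
    exact Set.indicator_le' hφC (fun _ _ => mul_nonneg hk.nonneg hB) x
  have hsplit : ∀ (ν : Measure ℝ) [IsFiniteMeasure ν],
      ∫ x in Set.Ioi a, k ((t - x) / b) * w x ∂ν =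
        ∫ x in J, P ((t - x) / b) * w x ∂ν - ∫ x in J, Q ((t - x) / b) * w x ∂ν := by
    intro ν _
    rw [← integral_sub (hint hP hP0 hPC ν) (hint hQ hQ0 hQC ν),
      setIntegral_eq_of_subset_of_forall_sdiff_eq_zero measurableSet_Ioi Set.inter_subset_left]
    · refine setIntegral_congr_fun hJ.measurableSet fun x hx => ?_
      rw [hk.eq_sub _ hx.2, sub_mul]
    · intro x hx
      rw [hk.eq_zero _ fun hx' => hx.2 ⟨hx.1, hx'⟩, zero_mul]
  have b1 := abs_setIntegral_sub_le_of_monotoneOn h hJ hP (mul_nonneg hk.nonneg hB) hP0 hPC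
  have b2 := abs_setIntegral_sub_le_of_monotoneOn h hJ hQ (mul_nonneg hk.nonneg hB) hQ0 hQC
  rw [hsplit ν₁, hsplit ν₂]
  rw [_root_.abs_le] at *
  constructor <;> linarith [b1.1, b1.2, b2.1, b2.2]

end AntitoneDecomposition

theorem abs_one_div_sub_one_div_le {A B y δ : ℝ} (hy : 0 < y) (hB : y ≤ B) (h : |A - B| ≤ δ)
    (hδ : δ ≤ y / 2) : |1 / A - 1 / B| ≤ 2 / y ^ 2 * δ := by
  have hA : y / 2 ≤ A := by linarith [(abs_le.1 h).1]
  have hA0 : 0 < A := by linarith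
  have hB0 : 0 < B := by linarith
  have hδ0 : 0 ≤ δ := (abs_nonneg _).trans h
  rw [div_sub_div _ _ hA0.ne' hB0.ne', abs_div, abs_of_pos (mul_pos hA0 hB0), one_mul, mul_one,
    abs_sub_comm, div_le_iff₀ (mul_pos hA0 hB0)]
  have : y / 2 * y ≤ A * B := mul_le_mul hA hB hy.le hA0.le
  calc |A - B| ≤ δ := h
    _ = 2 / y ^ 2 * δ * (y / 2 * y) := by field_simp
    _ ≤ 2 / y ^ 2 * δ * (A * B) := by gcongr


/-! ### The estimators as integrals against empirical measures. -/

/-- Region of the uncensored pairs. -/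
def uncensored : Set (ℝ × ℝ) := {z | z.1 ≤ z.2}

theorem measurableSet_uncensored : MeasurableSet uncensored :=
  measurableSet_le measurable_fst measurable_snd

/-- The observed time as a function of the pair. -/
def minPair (z : ℝ × ℝ) : ℝ := min z.1 z.2

theorem measurable_minPair : Measurable minPair := measurable_fst.min measurable_snd

section Sample

variable {Ω : Type*} (T Y : ℕ → Ω → ℝ) (n : ℕ) (ω : Ω)

theorem subEmpirical_eq_empirical : subEmpirical T Y n ω = empirical T Y uncensored minPair n ω := by
  classical
  unfold subEmpirical eventMeasure empirical
  congr! 2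

theorem survivalEmpirical_eq_empirical :
    survivalEmpirical T n ω = empirical T Y Set.univ Prod.fst n ω := by
  simp [survivalEmpirical, empirical]

theorem integrable_empirical (D : Set (ℝ × ℝ)) (ζ : ℝ × ℝ → ℝ) (hn : n ≠ 0) (φ : ℝ → ℝ) :
    Integrable φ (empirical T Y D ζ n ω) := by
  refine Integrable.smul_measure ?_ (by simp [hn])
  exact integrable_finsetSum_measure.2 fun i _ => integrable_dirac (by simp)

theorem measureReal_empirical_le_one (D : Set (ℝ × ℝ)) (ζ : ℝ × ℝ → ℝ) (S : Set ℝ) :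
    (empirical T Y D ζ n ω).real S ≤ 1 := by
  refine (measureReal_mono (Set.subset_univ S)).trans ?_
  rw [measureReal_empirical _ _ _ _ _ _ .univ]
  have : ∑ i ∈ Finset.range n, (D ∩ ζ ⁻¹' Set.univ).indicator (1 : ℝ × ℝ → ℝ) (T i ω, Y i ω) ≤
      n := by
    refine (Finset.sum_le_card_nsmul _ _ 1 fun i _ =>
      Set.indicator_le' (fun _ _ => le_rfl) (fun _ _ => zero_le_one) _).trans (by simp)
  rcases n.eq_zero_or_pos with rfl | hn
  · simp
  · have hn' : (0 : ℝ) < n := by exact_mod_cast hn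
    rw [inv_mul_le_iff₀ hn', mul_one]
    exact this

theorem measureReal_empirical_Ici (x : ℝ) :
    (empirical T Y Set.univ minPair n ω).real (Set.Ici x) = (n : ℝ)⁻¹ * atRisk T Y n ω x := by
  classical
  rw [measureReal_empirical _ _ _ _ _ _ measurableSet_Ici, atRisk, Finset.card_filter]
  push_cast
  congr 1
  refine Finset.sum_congr rfl fun i _ => ?_
  simp only [Set.univ_inter, Set.indicator_apply, Set.mem_preimage, Set.mem_Ici, minPair, obs,
    Pi.one_apply]
  congr

theorem atRisk_antitone : Antitone (atRisk T Y n ω) := fun _ _ hxy => by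
  classical
  exact Finset.card_le_card (Finset.monotone_filter_right _ fun _ _ h => hxy.trans h)

theorem ae_atRisk_pos : ∀ᵐ x ∂(eventMeasure T Y n ω), 0 < atRisk T Y n ω x := by
  classical
  rw [ae_iff, eventMeasure, Measure.finsetSum_apply _ _]
  refine Finset.sum_eq_zero fun i hi => ?_
  rw [Measure.dirac_apply, Set.indicator_of_notMem]
  have : 0 < atRisk T Y n ω (obs T Y i ω) :=
    Finset.card_pos.2 ⟨i, Finset.mem_filter.2 ⟨(Finset.mem_filter.1 hi).1, le_rfl⟩⟩
  simpa using this.ne'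

/-- Dividing both `dN_n` and `Y_n` by `n` leaves the ratio unchanged. The density is finite where it
matters, because every event time has its own observation at risk. -/
theorem integral_nelsonAalen (hn : n ≠ 0) (φ : ℝ → ℝ) (a : ℝ) :
    ∫ x in Set.Ioi a, φ x ∂(nelsonAalen T Y n ω) =
      ∫ x in Set.Ioi a, φ x * (1 / (empirical T Y Set.univ minPair n ω).real (Set.Ici x))
        ∂(empirical T Y uncensored minPair n ω) := by
  have hm : Measurable fun x => ((atRisk T Y n ω x : ℕ) : ENNReal)⁻¹ := by
    refine Monotone.measurable fun x y hxy => ENNReal.inv_le_inv.2 ?_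
    exact_mod_cast atRisk_antitone T Y n ω hxy
  have hlt : ∀ᵐ x ∂((eventMeasure T Y n ω).restrict (Set.Ioi a)),
      ((atRisk T Y n ω x : ℕ) : ENNReal)⁻¹ < ⊤ := by
    refine ae_restrict_of_ae ?_
    filter_upwards [ae_atRisk_pos T Y n ω] with x hx
    simpa using hx
  rw [nelsonAalen, restrict_withDensity measurableSet_Ioi,
    integral_withDensity_eq_integral_toReal_smul hm hlt, ← subEmpirical_eq_empirical, subEmpirical,
    Measure.restrict_smul, integral_smul_measure, smul_eq_mul, ← integral_const_mul]
  refine integral_congr_ae (ae_of_all _ fun x => ?_)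
  have hn' : (n : ℝ) ≠ 0 := by exact_mod_cast hn
  simp only [measureReal_empirical_Ici, ENNReal.toReal_inv, ENNReal.toReal_natCast, smul_eq_mul]
  rw [one_div, mul_inv, inv_inv]
  field_simp

end Sample

/-! ### Population identities and rates of convergence. -/

section Rate

variable {Ω : Type*} [MeasurableSpace Ω] {μ : Measure Ω} [IsProbabilityMeasure μ]

namespace IndepNAPair

variable {T Y : ℕ → Ω → ℝ}

theorem map_pair (hp : IndepNAPair μ T Y) (i : ℕ) :
    μ.map (fun ω => (T i ω, Y i ω)) = (μ.map (T 0)).prod (μ.map (Y 0)) := by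
  rw [← hp.left_law i, ← hp.right_law i]
  exact (indepFun_iff_map_prod_eq_prod_map_map (hp.left_meas i).aemeasurable
    (hp.right_meas i).aemeasurable).1
    (hp.indep.comp (measurable_pi_apply i) (measurable_pi_apply i))

/-- The empirical measures have mean `population`. -/
theorem integral_integral_empirical (hp : IndepNAPair μ T Y) {D : Set (ℝ × ℝ)} {ζ : ℝ × ℝ → ℝ}
    (hD : MeasurableSet D) (hζ : Measurable ζ) {n : ℕ} (hn : n ≠ 0) {φ : ℝ → ℝ}
    (hφ : Measurable φ) {C : ℝ} (hC : ∀ x, |φ x| ≤ C) :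
    ∫ ω, ∫ x, φ x ∂(empirical T Y D ζ n ω) ∂μ = ∫ x, φ x ∂(population μ T Y D ζ) := by
  have hm : Measurable (D.indicator fun z => φ (ζ z)) := (hφ.comp hζ).indicator hD
  have hC0 : 0 ≤ C := (abs_nonneg _).trans (hC 0)
  have hi : ∀ i, ∫ ω, D.indicator (fun z => φ (ζ z)) (T i ω, Y i ω) ∂μ =
      ∫ x, φ x ∂(population μ T Y D ζ) := by
    intro i
    rw [population, integral_map hζ.aemeasurable hφ.aestronglyMeasurable, ← integral_indicator hD,
      hp.map_pair 0, ← hp.map_pair i,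
      integral_map (hp.measurable_pair i).aemeasurable hm.aestronglyMeasurable]
  simp only [integral_empirical]
  rw [integral_const_mul, integral_finsetSum]
  · simp only [hi, Finset.sum_const, Finset.card_range, nsmul_eq_mul]
    have hn' : (n : ℝ) ≠ 0 := by exact_mod_cast hn
    field_simp
  · intro i _
    refine Integrable.of_bound (hm.comp (hp.measurable_pair i)).aestronglyMeasurable C
      (ae_of_all _ fun ω => ?_)
    rw [Real.norm_eq_abs]
    by_cases h : (T i ω, Y i ω) ∈ D
    · simpa [h] using hC _
    · simpa [h] using hC0

theorem population_Ici (hp : IndepNAPair μ T Y) (x : ℝ) :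
    (population μ T Y Set.univ minPair).real (Set.Ici x) =
      (μ.map (T 0)).real (Set.Ici x) * (μ.map (Y 0)).real (Set.Ici x) := by
  have : minPair ⁻¹' Set.Ici x = Set.Ici x ×ˢ Set.Ici x := by
    ext z
    simp [minPair, Set.mem_prod, -Set.Ici_prod_Ici]
  rw [population, map_measureReal_apply measurable_minPair measurableSet_Ici,
    Measure.restrict_univ, hp.map_pair, this, measureReal_prod_prod]

theorem population_uncensored (hp : IndepNAPair μ T Y) {f : ℝ → ℝ} (hfm : Measurable f)
    (hf : μ.map (T 0) = volume.withDensity fun x => ENNReal.ofReal (f x)) :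
    population μ T Y uncensored minPair = volume.withDensity
      fun x => ENNReal.ofReal (f x) * (μ.map (Y 0)) (Set.Ici x) := by
  have := Measure.isProbabilityMeasure_map (μ := μ) (hp.right_meas 0).aemeasurable
  have hYm : Measurable fun x => (μ.map (Y 0)) (Set.Ici x) :=
    Antitone.measurable fun x y hxy => measure_mono (Set.Ici_subset_Ici.2 hxy)
  ext S hS
  have hpre : Measurable fun x => ENNReal.ofReal (f x) := hfm.ennreal_ofReal
  rw [population, Measure.map_apply measurable_minPair hS,
    Measure.restrict_apply (measurable_minPair hS), hp.map_pair,
    Measure.prod_apply ((measurable_minPair hS).inter measurableSet_uncensored),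
    withDensity_apply _ hS, hf, lintegral_withDensity_eq_lintegral_mul _ hpre
      (measurable_measure_prodMk_left ((measurable_minPair hS).inter measurableSet_uncensored)),
    ← lintegral_indicator hS]
  refine lintegral_congr fun x => ?_
  by_cases hx : x ∈ S
  · rw [Set.indicator_of_mem hx, Pi.mul_apply]
    congr 2
    ext y
    simp only [Set.mem_preimage, Set.mem_inter_iff, minPair, uncensored, Set.mem_ofPred_eq,
      Set.mem_Ici]
    exact ⟨fun h => h.2, fun h => ⟨by rwa [min_eq_left h], h⟩⟩
  · rw [Set.indicator_of_notMem hx, Pi.mul_apply]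
    have : Prod.mk x ⁻¹' (minPair ⁻¹' S ∩ uncensored) = ∅ := by
      ext y
      simp only [Set.mem_preimage, Set.mem_inter_iff, minPair, uncensored, Set.mem_ofPred_eq,
        Set.mem_empty_iff_false, iff_false, not_and]
      intro h h'
      exact hx (by rwa [min_eq_left h'] at h)
    rw [this, measure_empty, mul_zero]

theorem one_sub_distFun (hp : IndepNAPair μ T Y) {f : ℝ → ℝ}
    (hf : μ.map (T 0) = volume.withDensity fun x => ENNReal.ofReal (f x)) (x : ℝ) :
    1 - distFun μ (T 0) x = (μ.map (T 0)).real (Set.Ici x) := by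
  have := Measure.isProbabilityMeasure_map (μ := μ) (hp.left_meas 0).aemeasurable
  have hac : μ.map (T 0) ≪ volume := hf ▸ withDensity_absolutelyContinuous _ _
  rw [distFun, cdf_eq_real, ← probReal_compl_eq_one_sub measurableSet_Iic, Set.compl_Iic]
  exact measureReal_congr (hac.ae_eq Ioi_ae_eq_Ici)

theorem one_sub_distFun_obs_le (hp : IndepNAPair μ T Y) (x : ℝ) :
    1 - distFun μ (obs T Y 0) x ≤ (population μ T Y Set.univ minPair).real (Set.Ici x) := by
  have hobs : Measurable (obs T Y 0) := (hp.left_meas 0).min (hp.right_meas 0)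
  have := Measure.isProbabilityMeasure_map (μ := μ) hobs.aemeasurable
  have hlaw : population μ T Y Set.univ minPair = μ.map (obs T Y 0) := by
    rw [population, Measure.restrict_univ,
      Measure.map_map measurable_minPair (hp.measurable_pair 0)]
    rfl
  rw [distFun, cdf_eq_real, ← probReal_compl_eq_one_sub measurableSet_Iic, Set.compl_Iic, hlaw]
  exact measureReal_mono Set.Ioi_subset_Ici_self

/-- On a region where `P(X ≥ x) > 0`, the cumulative hazard is the sub-distribution of the
uncensored observations weighted by `1 / P(X ≥ x)`. -/
theorem setIntegral_cumHazard (hp : IndepNAPair μ T Y) {f : ℝ → ℝ} (hfm : Measurable f)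
    (hf0 : ∀ x, 0 ≤ f x) (hf : μ.map (T 0) = volume.withDensity fun x => ENNReal.ofReal (f x))
    {φ : ℝ → ℝ} {a c : ℝ} (hφ : ∀ x, c < x → φ x = 0)
    (hc : 0 < (population μ T Y Set.univ minPair).real (Set.Ici c)) :
    ∫ x in Set.Ioi a, φ x ∂(cumHazard f (distFun μ (T 0))) =
      ∫ x in Set.Ioi a, φ x * (1 / (population μ T Y Set.univ minPair).real (Set.Ici x))
        ∂(population μ T Y uncensored minPair) := by
  have := Measure.isProbabilityMeasure_map (μ := μ) (hp.left_meas 0).aemeasurable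
  have := Measure.isProbabilityMeasure_map (μ := μ) (hp.right_meas 0).aemeasurable
  have hFm : Measurable (distFun μ (T 0)) := (monotone_cdf (μ.map (T 0))).measurable
  have hYm : Measurable fun x => (μ.map (Y 0)) (Set.Ici x) :=
    Antitone.measurable fun x y hxy => measure_mono (Set.Ici_subset_Ici.2 hxy)
  rw [cumHazard, hp.population_uncensored hfm hf, restrict_withDensity measurableSet_Ioi,
    restrict_withDensity measurableSet_Ioi, integral_withDensity_eq_integral_toReal_smul,
    integral_withDensity_eq_integral_toReal_smul]
  · refine integral_congr_ae (ae_of_all _ fun x => ?_)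
    simp only [smul_eq_mul]
    rcases lt_or_ge c x with hx | hx
    · simp [hφ x hx]
    · have hpos : 0 < (population μ T Y Set.univ minPair).real (Set.Ici x) :=
        hc.trans_le (measureReal_mono (Set.Ici_subset_Ici.2 hx))
      rw [hp.population_Ici] at hpos ⊢
      have h1 : (μ.map (T 0)).real (Set.Ici x) ≠ 0 := fun h => by simp [h] at hpos
      have h2 : (μ.map (Y 0)).real (Set.Ici x) ≠ 0 := fun h => by simp [h] at hpos
      have h3 : ((μ.map (Y 0)) (Set.Ici x)).toReal = (μ.map (Y 0)).real (Set.Ici x) := rfl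
      rw [hazard, hp.one_sub_distFun hf, ENNReal.toReal_mul, h3,
        ENNReal.toReal_ofReal (div_nonneg (hf0 x) measureReal_nonneg), ENNReal.toReal_ofReal (hf0 x)]
      field_simp
  · exact hfm.ennreal_ofReal.mul hYm
  · exact ae_of_all _ fun x => ENNReal.mul_lt_top ENNReal.ofReal_lt_top (measure_lt_top _ _)
  · exact (hfm.div (measurable_const.sub hFm)).ennreal_ofReal
  · exact ae_of_all _ fun x => ENNReal.ofReal_lt_top

end IndepNAPair


theorem smooth_empirical_sub_integral {T Y : ℕ → Ω → ℝ} (hp : IndepNAPair μ T Y)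
    {k P Q : ℝ → ℝ} {r s C : ℝ} (hk : AntitoneDecomposition k P Q r s C)
    {D : Set (ℝ × ℝ)} {ζ : ℝ × ℝ → ℝ} (hD : MeasurableSet D) (hζ : Measurable ζ) {n : ℕ}
    (hn : n ≠ 0) {b : ℝ} (hb : 0 < b) (a t : ℝ) {ω : Ω} {δ : ℝ}
    (h : ∀ S, IsLowerSet S →
      |(empirical T Y D ζ n ω).real S - (population μ T Y D ζ).real S| ≤ δ) :
    |smooth k b a (empirical T Y D ζ n ω) t - ∫ ω', smooth k b a (empirical T Y D ζ n ω') t ∂μ| ≤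
      b⁻¹ * (4 * C * δ) := by
  have hm : Measurable fun x => k ((t - x) / b) :=
    hk.measurable.comp ((measurable_const.sub measurable_id).div_const b)
  have hmean := hp.integral_integral_empirical hD hζ hn
    (φ := (Set.Ioi a).indicator fun x => k ((t - x) / b)) (hm.indicator measurableSet_Ioi) (C := C)
    fun x => by
      by_cases hx : x ∈ Set.Ioi a
      · rw [Set.indicator_of_mem hx]
        exact hk.abs_le _
      · rw [Set.indicator_of_notMem hx, abs_zero]
        exact hk.nonneg
  simp only [integral_indicator measurableSet_Ioi] at hmean
  have key := hk.abs_integral_sub_le h (b := b) (a := a) (t := t) (c := t - b * r) hb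
    (fun x hx => by
      have := (lt_div_iff₀ hb).1 hx.1
      linarith) (w := fun _ => 1) (fun _ _ _ _ _ => le_rfl) zero_le_one
    (fun _ _ => zero_le_one) fun _ _ => le_rfl
  simp only [mul_one] at key
  simp only [smooth]
  rw [integral_const_mul, hmean, ← mul_sub, abs_mul, abs_of_pos (inv_pos.2 hb)]
  gcongr

/-- The rate of the kernel hazard estimator around its centring. -/
theorem hazardEstimator_sub_hazardCentring {T Y : ℕ → Ω → ℝ} (hp : IndepNAPair μ T Y)
    {k P Q : ℝ → ℝ} {r s C : ℝ} (hk : AntitoneDecomposition k P Q r s C)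
    {f : ℝ → ℝ} (hfm : Measurable f) (hf0 : ∀ x, 0 ≤ f x)
    (hf : μ.map (T 0) = volume.withDensity fun x => ENNReal.ofReal (f x))
    {n : ℕ} (hn : n ≠ 0) {b : ℝ} (hb : 0 < b) {a t c : ℝ} (htc : t - b * r ≤ c) {ℓ : ℝ}
    (hℓ : 0 < ℓ) (hc : ℓ ≤ (population μ T Y Set.univ minPair).real (Set.Ici c))
    {ω : Ω} {δ : ℝ} (hδ : 2 * δ ≤ ℓ / 2)
    (hX : ∀ S, IsLowerSet S → |(empirical T Y Set.univ minPair n ω).real S -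
      (population μ T Y Set.univ minPair).real S| ≤ δ)
    (hN : ∀ S, IsLowerSet S → |(empirical T Y uncensored minPair n ω).real S -
      (population μ T Y uncensored minPair).real S| ≤ δ) :
    |hazardEstimator T Y k b a n t ω - hazardCentring f (distFun μ (T 0)) k b a t| ≤
      b⁻¹ * ((4 * C / ℓ ^ 2 + 4 * C / ℓ) * δ) := by
  have hsupp : ∀ x, (t - x) / b ∈ Set.Ioo r s → x ≤ c := fun x hx => by
    have := (lt_div_iff₀ hb).1 hx.1
    linarith
  have hzero : ∀ x, c < x → k ((t - x) / b) = 0 := fun x hx =>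
    hk.eq_zero _ fun h => (hsupp x h).not_gt hx
  set ν := population μ T Y uncensored minPair with hν
  set ν' := empirical T Y uncensored minPair n ω with hν'
  set y : ℝ → ℝ := fun x => (population μ T Y Set.univ minPair).real (Set.Ici x) with hy
  set y' : ℝ → ℝ := fun x => (empirical T Y Set.univ minPair n ω).real (Set.Ici x) with hy'
  have hyanti : Antitone y := fun u v huv => measureReal_mono (Set.Ici_subset_Ici.2 huv)
  have hyℓ : ∀ x ≤ c, ℓ ≤ y x := fun x hx => hc.trans (hyanti hx)
  have hest : hazardEstimator T Y k b a n t ω =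
      b⁻¹ * ∫ x in Set.Ioi a, k ((t - x) / b) * (1 / y' x) ∂ν' := by
    rw [hazardEstimator, smooth, integral_nelsonAalen T Y n ω hn]
  have hcen : hazardCentring f (distFun μ (T 0)) k b a t =
      b⁻¹ * ∫ x in Set.Ioi a, k ((t - x) / b) * (1 / y x) ∂ν := by
    rw [hazardCentring, smooth, hp.setIntegral_cumHazard hfm hf0 hf hzero (hℓ.trans_le hc)]
  have hδ0 : 0 ≤ δ := (abs_nonneg _).trans (hX ∅ isLowerSet_empty)
  have h1 : |∫ x in Set.Ioi a, k ((t - x) / b) * (1 / y' x) ∂ν' -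
      ∫ x in Set.Ioi a, k ((t - x) / b) * (1 / y x) ∂ν'| ≤ 4 * C / ℓ ^ 2 * δ := by
    rw [← integral_sub (integrable_empirical T Y n ω _ _ hn _).integrableOn
      (integrable_empirical T Y n ω _ _ hn _).integrableOn, ← Real.norm_eq_abs]
    have hbound : ∀ x ∈ Set.Ioi a, ‖k ((t - x) / b) * (1 / y' x) - k ((t - x) / b) * (1 / y x)‖ ≤
        C * (2 / ℓ ^ 2 * (2 * δ)) := by
      intro x _
      rw [← mul_sub, Real.norm_eq_abs, abs_mul]
      rcases lt_or_ge c x with hx | hx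
      · rw [hzero x hx, abs_zero, zero_mul]
        have := hk.nonneg
        positivity
      · have hdist := abs_measureReal_sub_le_of_ordConnected hX (Set.ordConnected_Ici (a := x))
        exact mul_le_mul (hk.abs_le _) (abs_one_div_sub_one_div_le hℓ (hyℓ x hx) hdist hδ)
          (abs_nonneg _) hk.nonneg
    refine (norm_setIntegral_le_of_norm_le_const (measure_lt_top _ _) hbound).trans ?_
    have hC := hk.nonneg
    refine (mul_le_of_le_one_right (by positivity)
      (measureReal_empirical_le_one T Y n ω _ _ _)).trans (le_of_eq (by ring))
  have h2 := hk.abs_integral_sub_le hN (b := b) (a := a) (t := t) (c := c) hb hsupp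
    (w := fun x => 1 / y x) (fun u hu v hv huv =>
      one_div_le_one_div_of_le (hℓ.trans_le (hyℓ v hv)) (hyanti huv))
    (B := 1 / ℓ) (by positivity) (fun x hx => one_div_nonneg.2 (hℓ.le.trans (hyℓ x hx)))
    fun x hx => one_div_le_one_div_of_le hℓ (hyℓ x hx)
  rw [hest, hcen, ← mul_sub, abs_mul, abs_of_pos (inv_pos.2 hb)]
  refine mul_le_mul_of_nonneg_left ?_ (inv_pos.2 hb).le
  refine (abs_sub_le _ (∫ x in Set.Ioi a, k ((t - x) / b) * (1 / y x) ∂ν') _).trans ?_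
  calc _ ≤ 4 * C / ℓ ^ 2 * δ + 4 * (C * (1 / ℓ)) * δ := add_le_add h1 h2
    _ = _ := by ring

theorem tendsto_sqrt_log_div : Tendsto (fun n : ℕ => Real.sqrt (Real.log n / n)) atTop (𝓝 0) := by
  have h := Real.isLittleO_log_id_atTop.tendsto_div_nhds_zero.comp tendsto_natCast_atTop_atTop
  rw [← Real.sqrt_zero]
  exact (Real.continuous_sqrt.tendsto 0).comp h

/-- Both readings of the linearization, from the uniform rates for the empirical measures. -/
theorem uniformRate_of_empirical {T Y : ℕ → Ω → ℝ} (hp : IndepNAPair μ T Y)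
    {k P Q : ℝ → ℝ} {r s C : ℝ} (hk : AntitoneDecomposition k P Q r s C) (hr : r < 0)
    {f : ℝ → ℝ} (hfm : Measurable f) (hf0 : ∀ x, 0 ≤ f x)
    (hf : μ.map (T 0) = volume.withDensity fun x => ENNReal.ofReal (f x))
    {D : Set (ℝ × ℝ)} {ζ : ℝ × ℝ → ℝ} (hD : MeasurableSet D) (hζ : Measurable ζ)
    {b : ℕ → ℝ} (hb_pos : ∀ n, 1 ≤ n → 0 < b n) (hb_zero : Tendsto b atTop (𝓝 0)) (a : ℝ) {τ c : ℝ}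
    (hτc : τ < c) (hc : distFun μ (obs T Y 0) c < 1) {ω : Ω}
    (hX : ∀ᶠ n : ℕ in atTop, ∀ S, IsLowerSet S → |(empirical T Y Set.univ minPair n ω).real S -
      (population μ T Y Set.univ minPair).real S| ≤ 3 * Real.sqrt (Real.log n / n))
    (hN : ∀ᶠ n : ℕ in atTop, ∀ S, IsLowerSet S → |(empirical T Y uncensored minPair n ω).real S -
      (population μ T Y uncensored minPair).real S| ≤ 3 * Real.sqrt (Real.log n / n))
    (hE : ∀ᶠ n : ℕ in atTop, ∀ S, IsLowerSet S → |(empirical T Y D ζ n ω).real S -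
      (population μ T Y D ζ).real S| ≤ 3 * Real.sqrt (Real.log n / n)) :
    UniformRate τ b fun n t =>
      hazardEstimator T Y k (b n) a n t ω - hazardCentring f (distFun μ (T 0)) k (b n) a t -
        (smooth k (b n) a (empirical T Y D ζ n ω) t -
          ∫ ω', smooth k (b n) a (empirical T Y D ζ n ω') t ∂μ) / (1 - distFun μ (obs T Y 0) t) := by
  set ℓ := 1 - distFun μ (obs T Y 0) c with hℓdef
  have hℓ : 0 < ℓ := sub_pos.2 hc
  refine ⟨3 * (4 * C / ℓ ^ 2 + 8 * C / ℓ), ?_⟩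
  have hsmall : ∀ᶠ n : ℕ in atTop, Real.sqrt (Real.log n / n) < ℓ / 12 :=
    tendsto_sqrt_log_div.eventually_lt_const (by positivity)
  have hbsmall : ∀ᶠ n : ℕ in atTop, b n < (c - τ) / (-r) :=
    hb_zero.eventually_lt_const (div_pos (sub_pos.2 hτc) (neg_pos.2 hr))
  filter_upwards [hX, hN, hE, hsmall, hbsmall, eventually_ge_atTop 1] with n hXn hNn hEn hsn hbn hn
    t ht
  have hb := hb_pos n hn
  have htc : t - b n * r ≤ c := by
    have := (lt_div_iff₀ (neg_pos.2 hr)).1 hbn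
    linarith [ht.2]
  set ρ := Real.sqrt (Real.log n / n)
  have hρ : 0 ≤ ρ := Real.sqrt_nonneg _
  have h1 := hazardEstimator_sub_hazardCentring hp hk hfm hf0 hf (by omega : n ≠ 0) hb (a := a) htc
    hℓ (hp.one_sub_distFun_obs_le c) (δ := 3 * ρ) (by linarith) hXn hNn
  have h2 := smooth_empirical_sub_integral hp hk hD hζ (by omega : n ≠ 0) hb a t hEn
  have hLt : ℓ ≤ 1 - distFun μ (obs T Y 0) t := by
    have : distFun μ (obs T Y 0) t ≤ distFun μ (obs T Y 0) c :=
      monotone_cdf (μ.map (obs T Y 0)) (ht.2.trans hτc.le)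
    linarith
  refine (abs_sub _ _).trans ?_
  rw [abs_div, abs_of_pos (hℓ.trans_le hLt)]
  have hC := hk.nonneg
  have hbinv := (inv_pos.2 hb).le
  have h3 := div_le_div₀ (by positivity) h2 hℓ hLt
  calc _ ≤ _ := add_le_add h1 h3
    _ = _ := by ring

end Rate

end CensoredNA

theorem theorem2 {Ω : Type*} [MeasurableSpace Ω] (μ : Measure Ω) [IsProbabilityMeasure μ]
    -- survival and censoring times: nonnegative, with common laws, each sequence NA,
    -- the two sequences independent of each other
    (T Y : ℕ → Ω → ℝ)
    (hTm : ∀ i, Measurable (T i)) (hYm : ∀ i, Measurable (Y i))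
    (hT0 : ∀ i, ∀ᵐ ω ∂μ, 0 ≤ T i ω) (hY0 : ∀ i, ∀ᵐ ω ∂μ, 0 ≤ Y i ω)
    (hTid : ∀ i, μ.map (T i) = μ.map (T 0)) (hYid : ∀ i, μ.map (Y i) = μ.map (Y 0))
    (hTNA : CensoredNA.NegAssociated μ T) (hYNA : CensoredNA.NegAssociated μ Y)
    (hTY : IndepFun (fun ω i => T i ω) (fun ω i => Y i ω) μ)
    -- distribution functions of `T i` and of `X i = min (T i) (Y i)`, and the left endpoint of `F`
    (F L : ℝ → ℝ) (hF : F = CensoredNA.distFun μ (T 0))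
    (hL : L = CensoredNA.distFun μ (CensoredNA.obs T Y 0))
    (a : ℝ) (ha : a = CensoredNA.leftEndpoint F)
    (τ : ℝ) (hτ_left : a < τ)
    (hτ_right : (τ : EReal) < CensoredNA.rightEndpoint L)
    -- `f` is the density of `T i`, `g` the density of `Y i` on `[0, τ]`; bounded on `[0, τ]`
    (f g : ℝ → ℝ) (hfm : Measurable f) (hgm : Measurable g)
    (hf0 : ∀ x, 0 ≤ f x) (hg0 : ∀ x, 0 ≤ g x)
    (hf : μ.map (T 0) = volume.withDensity fun x => ENNReal.ofReal (f x))
    (hg : (μ.map (Y 0)).restrict (Set.Icc 0 τ) =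
      (volume.restrict (Set.Icc 0 τ)).withDensity fun x => ENNReal.ofReal (g x))
    (hfb : ∃ M : ℝ, ∀ x ∈ Set.Icc 0 τ, f x ≤ M) (hgb : ∃ M : ℝ, ∀ x ∈ Set.Icc 0 τ, g x ≤ M)
    -- the kernel: a probability density of bounded variation on `(r, s)`
    (r s : ℝ) (hr : r < 0) (hs : 0 < s) (k : ℝ → ℝ)
    (hk0 : ∀ u, 0 ≤ k u) (hksupp : ∀ u, u ∉ Set.Ioo r s → k u = 0)
    (hkint : ∫ u, k u = 1) (hkbv : BoundedVariationOn k (Set.Ioo r s))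
    -- the bandwidths
    (b : ℕ → ℝ) (hb_pos : ∀ n, 1 ≤ n → 0 < b n) (hb_zero : Tendsto b atTop (𝓝 0))
    (hb_rate : (fun n : ℕ => (b n)⁻¹) =o[atTop] fun n : ℕ => Real.sqrt ((n : ℝ) / Real.log n)) :
    -- the claim, for either reading of `F_{*n}` in `f_n^*`
    (∀ᵐ ω ∂μ, CensoredNA.UniformRate τ b fun n t =>
      CensoredNA.hazardEstimator T Y k (b n) a n t ω - CensoredNA.hazardCentring f F k (b n) a t -
        (CensoredNA.fStar T Y k (b n) a n t ω -
          ∫ ω', CensoredNA.fStar T Y k (b n) a n t ω' ∂μ) / (1 - L t)) ∧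
    (∀ᵐ ω ∂μ, CensoredNA.UniformRate τ b fun n t =>
      CensoredNA.hazardEstimator T Y k (b n) a n t ω - CensoredNA.hazardCentring f F k (b n) a t -
        (CensoredNA.fStarSurvival T k (b n) a n t ω -
          ∫ ω', CensoredNA.fStarSurvival T k (b n) a n t ω' ∂μ) / (1 - L t)) := by
  have hp : CensoredNA.IndepNAPair μ T Y := ⟨hTNA, hYNA, hTm, hYm, hTid, hYid, hTY⟩
  obtain ⟨P, Q, C, hk⟩ := CensoredNA.exists_antitoneDecomposition (hr.trans hs) hkbv hksupp
  obtain ⟨c, hLc, hτc⟩ : ∃ c, L c < 1 ∧ τ < c := by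
    obtain ⟨c, hc⟩ := lt_iSup_iff.1 hτ_right
    obtain ⟨hLc, hc⟩ := lt_iSup_iff.1 hc
    exact ⟨c, hLc, EReal.coe_lt_coe_iff.1 hc⟩
  have hX := hp.ae_eventually_abs_empirical_sub_le (D := Set.univ) .univ
    CensoredNA.measurable_minPair
    (fun S hS y u v huv hu => ⟨trivial, hS (min_le_min_right y huv) hu.2⟩)
    (fun S hS => Or.inl fun x u v huv hu => ⟨trivial, hS (min_le_min_left x huv) hu.2⟩)
  have hN := hp.ae_eventually_abs_empirical_sub_le CensoredNA.measurableSet_uncensored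
    CensoredNA.measurable_minPair
    (fun S hS y u v huv hu =>
      ⟨le_trans huv hu.1, hS (min_le_min_right y huv) hu.2⟩)
    (fun S hS => Or.inr fun x u v huv hu => by
      have hxu : x ≤ u := hu.1
      have hmem : min x u ∈ S := hu.2
      refine ⟨hxu.trans huv, ?_⟩
      change min x v ∈ S
      rwa [min_eq_left (hxu.trans huv), ← min_eq_left hxu])
  have hS := hp.ae_eventually_abs_empirical_sub_le (D := Set.univ) .univ measurable_fst
    (fun S hS y u v huv hu => ⟨trivial, hS huv hu.2⟩)
    (fun S hS => Or.inl fun x u v huv hu => ⟨trivial, hu.2⟩)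
  subst hF hL
  constructor
  · filter_upwards [hX, hN] with ω hXω hNω
    simp only [CensoredNA.fStar, CensoredNA.subEmpirical_eq_empirical]
    exact CensoredNA.uniformRate_of_empirical hp hk hr hfm hf0 hf
      CensoredNA.measurableSet_uncensored CensoredNA.measurable_minPair hb_pos hb_zero a hτc hLc
      hXω hNω hNω
  · filter_upwards [hX, hN, hS] with ω hXω hNω hSω
    simp only [CensoredNA.fStarSurvival, CensoredNA.survivalEmpirical_eq_empirical T Y]
    exact CensoredNA.uniformRate_of_empirical hp hk hr hfm hf0 hf .univ measurable_fst hb_pos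
      hb_zero a hτc hLc hXω hNω hSω
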